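/- Let $N\ge 2$, $\omega=e^{2\pi i/N}$, $X=\sum_\ell|\ell\rangle\langle\ell+1|$ (mod $N$), $Z=\sum_\ell\omega^\ell|\ell\rangle\langle\ell|$, and let the Heisenberg–Weyl operators be $X^iZ^j$, $0\le i,j<N$; those with $(i,j)\neq(0,0)$ are written $W_\alpha$ ($N^2-1$ labels $\alpha$). Consider the $SU(N)$ AKLT state on an open chain of $n$ sites: each site carries $\mathbf N\otimes\bar{\mathbf N}$, the $\bar{\mathbf N}$ spin of each site forms a singlet with the $\mathbf N$ spin of the next one, the $\mathbf N$ spin of the first site is in an edge state $|\psi\rangle\in\mathbb C^N$, the $\bar{\mathbf N}$ spin of the last site forms a singlet with one free $\mathbf N$ spin (the virtual system), and every site is then projected onto the adjoint irrep $\mathbf{N^2-1}\subset\mathbf N\otimes\bar{\mathbf N}$ and the state multiplied by $(N/\sqrt{N^2-1})^n$. Sites are measured one after the other in orthonormal bases of the on-site space, each basis possibly depending on the earlier outcomes. Then: 1. The state is normalized if $\psi$ is. A measurement of the sites multiplies $|\psi\rangle$, on the virtual space, by the product of the Kraus operators of the outcomes (first site acting first), where a unit vector $T=\sum T_{lr}|l\rangle|r\rangle$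 of the on-site space has Kraus operator $\sqrt{N/(N^2-1)}\,T^\dagger$. 2. The vectors $\sqrt2 M_\beta$, with $M_\beta$ the generalized Gell-Mann matrices ($\operatorname{tr}M_\beta M_\gamma=\delta_{\beta\gamma}/2$), form an on-site orthonormal basis with Kraus operators $A_\beta=\sqrt{2N/(N^2-1)}\,M_\beta$, and there is a unitary $(u_{\alpha\beta})$ with $\sum_\beta u_{\alpha\beta}A_\beta=W_\alpha/\sqrt{N^2-1}$. The $X^iZ^j$ are unitary. 3. For every unitary $V$, the on-site basis with vectors $N^{-1/2}V^\dagger W_\alpha^\dagger V$ (the Heisenberg–Weyl basis rotated by the on-site symmetry) is orthonormal and has the Kraus operators $V^\dagger W_\alpha V/\sqrt{N^2-1}=W_\alpha G_\alpha(V)/\sqrt{N^2-1}$, where $G_\alpha(V)=W_\alpha^\dagger V^\dagger W_\alpha V$ is the gate induced by outcome $\alpha$, with byproduct $W_\alpha$. Call $V$ elementary if $V=e^{i\theta|\lambda\rangle\langle\lambda|}$ with $\theta\in\mathbb R$ and $|\lambda\rangle$ a unit eigenvector of one of $Z,X,XZ,X^2Z,\dots,X^{N-1}Z$, and consider adaptive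 schemes in which each site is measured in the basis of part 3 for an elementary $V$ chosen from the earlier outcomes. 4. (Gates and byproducts) For every such scheme and every unit $\psi$, each sequence of outcomes on $n$ sites has probability $(N^2-1)^{-n}$; and for each sequence of outcomes there are $G\in SU(N)$, $i$, $j$ and a scalar $c\ne0$ such that it acts on the virtual space, for all $\psi$, as $c\,X^iZ^jG$. 5. (Success probability) For elementary $V$, $G_\alpha(V)\in SU(N)$, and $G_\alpha(V)=\mathbb 1$ if and only if $V$ commutes with $W_\alpha$; if $G_\alpha(V)\neq\mathbb 1$ and ($N>2$ or $V^2\ne\mathbb 1$), then $G_\alpha(V)$ is not a scalar either. If the $V$ used at a site is not $\mathbb 1$, then, conditionally on any earlier outcomes and for every unit $\psi$, the measurement of that site induces a nontrivial gate $G_\alpha(V)\ne\mathbb 1$ with probability exactly $N/(N+1)$. 6. (All of $SU(N)$) For every $T\in SU(N)$ and every $\varepsilon>0$ there are such a scheme, a number $n$ of sites, and a set of outcome sequences, each of which acts on the virtual space as $c\,X^iZ^jT$ with a scalar $c\neq0$ and exponents $i,j$ determined by the outcomes, whose total probability is at least $1-\varepsilon$ for every unit $\psi$. -/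

import Mathlib

open scoped Matrix

noncomputable section

namespace AKLT

/-- The `N² - 1` labels: pairs in `{0, …, N-1}²` other than `(0, 0)`. -/
abbrev Label (N : ℕ) : Type :=
  {p : Fin N × Fin N // ¬ (p.1.val = 0 ∧ p.2.val = 0)}

/-! ### Heisenberg–Weyl operators -/

/-- The shift `X = ∑ ℓ, |ℓ⟩⟨ℓ + 1|` (indices modulo `N`). -/
def shiftX (N : ℕ) : Matrix (Fin N) (Fin N) ℂ :=
  Matrix.of fun a b => if b.val = (a.val + 1) % N then 1 else 0

/-- The clock `Z = ∑ ℓ, ω ^ ℓ |ℓ⟩⟨ℓ|`, `ω = exp (2πi / N)`. -/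
def clockZ (N : ℕ) : Matrix (Fin N) (Fin N) ℂ :=
  Matrix.diagonal fun l => Complex.exp (2 * Real.pi * Complex.I / N) ^ l.val

/-- The Heisenberg–Weyl operator `X ^ i Z ^ j`. -/
def hw (N : ℕ) (p : Fin N × Fin N) : Matrix (Fin N) (Fin N) ℂ :=
  shiftX N ^ p.1.val * clockZ N ^ p.2.val

/-! ### Generalized Gell-Mann matrices, normalized by `tr (M_a M_b) = δ_ab / 2` -/

/-- The label `(i, j)` stands for the symmetric matrix `X_ij` if `i < j`, for the antisymmetric
matrix `Y_ji` if `j < i`, and for the `i`-th diagonal matrix if `i = j ≥ 1`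
(all indices start at `0`). -/
def gellMann (N : ℕ) (b : Label N) : Matrix (Fin N) (Fin N) ℂ :=
  let i := b.1.1
  let j := b.1.2
  if i < j then
    (1 / 2 : ℂ) • (Matrix.single i j 1 + Matrix.single j i 1)
  else if j < i then
    (-Complex.I / 2) • (Matrix.single j i 1 - Matrix.single i j 1)
  else
    ((1 / Real.sqrt (2 * (i.val + 1) * i.val) : ℝ) : ℂ) •
      ((∑ l : Fin N with l < i, Matrix.single l l 1) - (i.val : ℂ) • Matrix.single i i 1)

/-! ### One site: two virtual spins `N ⊗ N̄ = (N² - 1) ⊕ 1` -/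

/-- The space `ℂ^N ⊗ ℂ^N` carrying `N ⊗ N̄`: a vector has components `T (l, r)`, the index `l`
belonging to `N` and the index `r` to `N̄`. -/
abbrev PairSpace (N : ℕ) : Type := EuclideanSpace ℂ (Fin N × Fin N)

/-- The vector with components the entries of a matrix. -/
def toPair (N : ℕ) (T : Matrix (Fin N) (Fin N) ℂ) : PairSpace N :=
  WithLp.toLp 2 fun p => T p.1 p.2

/-- The matrix with entries the components of a vector. -/
def toMat (N : ℕ) (T : PairSpace N) : Matrix (Fin N) (Fin N) ℂ :=
  Matrix.of fun l r => T (l, r)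

/-- The normalized singlet `∑ m, |m⟩ ⊗ |m⟩ / √N` of `N ⊗ N̄`. -/
def singlet (N : ℕ) : PairSpace N :=
  WithLp.toLp 2 fun p => if p.1 = p.2 then ((1 / Real.sqrt N : ℝ) : ℂ) else 0

/-- The on-site Hilbert space: the orthogonal complement of the singlet in `N ⊗ N̄`, which carries
the adjoint irrep of dimension `N² - 1`. -/
def adjointSpace (N : ℕ) : Submodule ℂ (PairSpace N) :=
  (Submodule.span ℂ {singlet N})ᗮ

/-- The action `V ⊗ V̄` on `N ⊗ N̄`. -/
def pairAction (N : ℕ) (V : Matrix (Fin N) (Fin N) ℂ) (T : PairSpace N) : PairSpace N :=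
  WithLp.toLp 2 fun p => ∑ q : Fin N × Fin N, V p.1 q.1 * star (V p.2 q.2) * T q

/-- The kernel `⟨s| (1 - |singlet⟩⟨singlet|) |t⟩` of the projection onto the adjoint irrep. -/
def adjointProj (N : ℕ) (s t : Fin N × Fin N) : ℂ :=
  (if s = t then 1 else 0) - singlet N s * star (singlet N t)

/-! ### The valence bond state on an open chain -/

/-- The valence bonds on `n` sites: the `N̄` spin of each site forms a singlet with the `N` spin of
the next one; the `N` spin of the first site is in the edge state `ψ`, and the `N̄` spin of the last
site forms a singlet with one free `N` spin, whose index is `e`. -/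
def bondState (N n : ℕ) (ψ : Fin N → ℂ) (t : Fin n → Fin N × Fin N) (e : Fin N) : ℂ :=
  let left : Fin (n + 1) → Fin N := Fin.snoc (fun k => (t k).1) e
  ψ (left 0) * ∏ k : Fin n, singlet N (left k.succ, (t k).2)

/-- The `SU(N)` AKLT state with edge state `ψ`: the valence bonds, projected onto the adjoint irrep
at each of the `n` sites, and normalized. The `N` spin with index `e` at the open end is the virtual
system. -/
def akltState (N n : ℕ) (ψ : Fin N → ℂ) (s : Fin n → Fin N × Fin N) (e : Fin N) : ℂ :=
  ((N / Real.sqrt ((N : ℝ) ^ 2 - 1) : ℝ) : ℂ) ^ n *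
    ∑ t : Fin n → Fin N × Fin N, (∏ k, adjointProj N (s k) (t k)) * bondState N n ψ t e

/-! ### Adaptive on-site projective measurements -/

/-- A complete on-site projective measurement: an orthonormal basis of the on-site space. -/
abbrev SiteBasis (N : ℕ) : Type := OrthonormalBasis (Label N) ℂ (adjointSpace N)

/-- The virtual state (not normalized) after the outcomes `o` on all `n` sites, where each site is
measured in a basis `B h` that may depend on the list `h` of the earlier outcomes. -/
def postState (N n : ℕ) (B : List (Label N) → SiteBasis N) (ψ : Fin N → ℂ)
    (o : Fin n → Label N) : Fin N → ℂ := fun e =>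
  ∑ s : Fin n → Fin N × Fin N,
    (∏ k : Fin n, star ((B ((List.ofFn o).take k.val) (o k) : PairSpace N) (s k))) *
      akltState N n ψ s e

/-- The Born probability of the outcomes `o`. -/
def prob (N n : ℕ) (B : List (Label N) → SiteBasis N) (ψ : Fin N → ℂ)
    (o : Fin n → Label N) : ℝ :=
  ∑ e, ‖postState N n B ψ o e‖ ^ 2

/-- The Kraus operator on the virtual space that belongs to a vector of the on-site space. -/
def kraus (N : ℕ) (T : PairSpace N) : Matrix (Fin N) (Fin N) ℂ :=
  ((Real.sqrt (N / ((N : ℝ) ^ 2 - 1)) : ℝ) : ℂ) • (toMat N T)ᴴ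

/-- The product of the Kraus operators of the outcomes `o`, that of the first site acting first. -/
def virtualOp (N n : ℕ) (B : List (Label N) → SiteBasis N) (o : Fin n → Label N) :
    Matrix (Fin N) (Fin N) ℂ :=
  (List.ofFn fun k : Fin n => kraus N (B ((List.ofFn o).take k.val) (o k))).reverse.prod

/-! ### Rotated bases and gates -/

/-- The on-site vector whose Kraus operator is proportional to `X ^ i Z ^ j`. -/
def hwVector (N : ℕ) (α : Label N) : PairSpace N :=
  toPair N (((1 / Real.sqrt N : ℝ) : ℂ) • (hw N α.1)ᴴ)

/-- `B` is the Heisenberg–Weyl basis rotated by the on-site symmetry action of `V†`. -/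
def IsRotatedBy (N : ℕ) (V : Matrix (Fin N) (Fin N) ℂ) (B : SiteBasis N) : Prop :=
  ∀ α, (B α : PairSpace N) = pairAction N Vᴴ (hwVector N α)

/-- The operators `Z, X, XZ, X²Z, …, X^(N-1)Z`. -/
def axisOperators (N : ℕ) : Set (Matrix (Fin N) (Fin N) ℂ) :=
  {O | O = shiftX N ∨ ∃ j : Fin N, O = shiftX N ^ j.val * clockZ N}

/-- `V = exp (iθ |v⟩⟨v|)` for a unit eigenvector `v` of one of the operators above. -/
def IsElementaryGate (N : ℕ) (V : Matrix (Fin N) (Fin N) ℂ) : Prop :=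
  ∃ O ∈ axisOperators N, ∃ (v : Fin N → ℂ) (μ : ℂ) (θ : ℝ),
    ∑ e, ‖v e‖ ^ 2 = 1 ∧ O *ᵥ v = μ • v ∧
      V = NormedSpace.exp ((Complex.I * θ) • Matrix.vecMulVec v (star v))

/-- An adaptive scheme: after the earlier outcomes `h`, the next site is measured in the basis
rotated by the elementary gate `gate h`. -/
structure GateProtocol (N : ℕ) where
  gate : List (Label N) → Matrix (Fin N) (Fin N) ℂ
  basis : List (Label N) → SiteBasis N
  elementary : ∀ h, IsElementaryGate N (gate h)
  rotated : ∀ h, IsRotatedBy N (gate h) (basis h)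

/-- The gate that remains when the byproduct `W = X ^ i Z ^ j` is pulled out of `V† W V` to the
left: `V† W V = W (W† V† W V)`. -/
def inducedGate (N : ℕ) (V : Matrix (Fin N) (Fin N) ℂ) (α : Label N) :
    Matrix (Fin N) (Fin N) ℂ :=
  (hw N α.1)ᴴ * Vᴴ * hw N α.1 * V

end AKLT

end

/-!
Projecting one more site multiplies the virtual vector by the tensor of a matrix product state, so
measuring a site multiplies it by the Kraus operator of the outcome. Here these operators are
unitary up to the scalar `1 / √(N² - 1)`, whence the outcomes are equidistributed. Heisenberg–Weyl
operators commute up to phases, so every byproduct can be moved to the left; this conjugates the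
gates measured later, which keeps them elementary.

An elementary gate is a complex reflection in an eigenvector of an operator `X` or `XʲZ`. The
spectrum of that operator is simple, so the gate commutes with `W_α` exactly when the operator
does, that is, when `α` is a multiple of its label; the other `N² - N` of the `N² - 1` outcomes
induce a nontrivial gate.

For universality, fix an eigenbasis of `X` or `Z`. To put the phase `z` on one basis vector and
`z⁻¹` on another, measure the reflection for the phase `z`: the outcome moves the phase still
missing to a translate of the basis vector, and this random walk almost surely ends at the other
one. With an `N`-th root in place of `z` this gives, up to a scalar, the complex reflections in the
vectors of both bases. The directions all of whose reflections can be performed are closed under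
these reflections, so with two directions that are not orthogonal they contain the whole plane:
rotating one about the other keeps doubling the range of latitudes reached. The standard basis
together with `(1, …, 1)`, an eigenvector of `X`, therefore yields every direction, and reflections
generate the unitary group.
-/

noncomputable section

namespace AKLT

section Reflections

variable {n : Type*} [Fintype n]

lemma dotProduct_self_ne_zero {w : n → ℂ} (hw : w ≠ 0) : star w ⬝ᵥ w ≠ 0 := by
  open scoped ComplexOrder in
  simpa using hw

lemma star_star_dotProduct (v w : n → ℂ) : star (star v ⬝ᵥ w) = star w ⬝ᵥ v := by
  rw [Matrix.star_dotProduct, star_star]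

lemma star_dotProduct_self_eq_sum (v : n → ℂ) :
    star v ⬝ᵥ v = ((∑ i, ‖v i‖ ^ 2 : ℝ) : ℂ) := by
  simp [dotProduct, Complex.conj_mul']

lemma exists_smul_unit_eq {w : n → ℂ} (hw : w ≠ 0) :
    ∃ (c : ℂ) (e : n → ℂ), c ≠ 0 ∧ star e ⬝ᵥ e = 1 ∧ c • e = w := by
  set r := ∑ i, ‖w i‖ ^ 2
  have hr : (Real.sqrt r : ℂ) ^ 2 = star w ⬝ᵥ w := by
    rw [star_dotProduct_self_eq_sum, ← Complex.ofReal_pow,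
      Real.sq_sqrt (Finset.sum_nonneg fun _ _ => by positivity)]
  have hr0 : (Real.sqrt r : ℂ) ≠ 0 := fun h0 =>
    dotProduct_self_ne_zero hw (by rw [← hr, h0, zero_pow two_ne_zero])
  refine ⟨Real.sqrt r, (Real.sqrt r : ℂ)⁻¹ • w, hr0, ?_, smul_inv_smul₀ hr0 w⟩
  simp only [star_smul, smul_dotProduct, dotProduct_smul, smul_eq_mul, ← hr, star_inv₀,
    Complex.star_def, Complex.conj_ofReal]
  field_simp

lemma exists_phase {a b : ℂ} (h : ‖a‖ = ‖b‖) : ∃ z : ℂ, ‖z‖ = 1 ∧ b = z * a := by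
  rcases eq_or_ne a 0 with rfl | ha
  · exact ⟨1, by simp, by simpa [eq_comm] using h⟩
  · exact ⟨b / a, by rw [norm_div, ← h, div_self (norm_ne_zero_iff.2 ha)], by field_simp⟩

lemma star_mul_self_of_norm_eq_one {z : ℂ} (hz : ‖z‖ = 1) : star z * z = 1 := by
  rw [Complex.star_def, Complex.conj_mul', hz]
  norm_num

lemma norm_sub_one_sq {z : ℂ} (hz : ‖z‖ = 1) : ‖z - 1‖ ^ 2 = 2 - 2 * z.re := by
  rw [Complex.sq_norm, Complex.normSq_sub, ← Complex.sq_norm, hz]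
  norm_num

lemma norm_one_add_mul_sub_one_sq {z : ℂ} (hz : ‖z‖ = 1) (x : ℝ) :
    ‖1 + x * (z - 1)‖ ^ 2 = 1 - ‖z - 1‖ ^ 2 * (x * (1 - x)) := by
  rw [Complex.sq_norm, Complex.normSq_add, ← Complex.sq_norm (_ * _), norm_mul, mul_pow,
    norm_sub_one_sq hz]
  simp only [map_one, one_mul, Complex.norm_real, Real.norm_eq_abs, sq_abs, Complex.conj_re,
    Complex.re_ofReal_mul, Complex.sub_re, Complex.one_re]
  ring

lemma exists_norm_sub_one_sq_eq {d : ℝ} (hd : d ∈ Set.Icc 0 4) :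
    ∃ z : ℂ, ‖z‖ = 1 ∧ ‖z - 1‖ ^ 2 = d := by
  have hz : ‖Complex.exp (Real.arccos (1 - d / 2) * Complex.I)‖ = 1 :=
    Complex.norm_exp_ofReal_mul_I _
  refine ⟨_, hz, ?_⟩
  rw [norm_sub_one_sq hz, Complex.exp_ofReal_mul_I_re,
    Real.cos_arccos (by linarith [hd.2]) (by linarith [hd.1])]
  ring

section Matrices

variable [DecidableEq n]

lemma dotProduct_mulVec_of_mem_unitaryGroup {U : Matrix n n ℂ} (hU : U ∈ Matrix.unitaryGroup n ℂ)
    (v w : n → ℂ) : star (U *ᵥ v) ⬝ᵥ (U *ᵥ w) = star v ⬝ᵥ w := by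
  rw [Matrix.star_mulVec, ← Matrix.dotProduct_mulVec, Matrix.mulVec_mulVec,
    ← Matrix.star_eq_conjTranspose, Matrix.mem_unitaryGroup_iff'.1 hU, Matrix.one_mulVec]

/-- The complex reflection that multiplies `w` by `z` and fixes the orthogonal complement of `w`.
For `w = 0` the division by zero makes it the identity. -/
def complexReflection (w : n → ℂ) (z : ℂ) : Matrix n n ℂ :=
  1 + ((z - 1) / (star w ⬝ᵥ w)) • Matrix.vecMulVec w (star w)

@[simp]
lemma complexReflection_zero (z : ℂ) : complexReflection (0 : n → ℂ) z = 1 := by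
  simp [complexReflection]

@[simp]
lemma complexReflection_one (w : n → ℂ) : complexReflection w 1 = 1 := by
  simp [complexReflection]

lemma complexReflection_mulVec (w v : n → ℂ) (z : ℂ) :
    complexReflection w z *ᵥ v = v + ((z - 1) * (star w ⬝ᵥ v) / (star w ⬝ᵥ w)) • w := by
  rw [complexReflection, Matrix.add_mulVec, Matrix.one_mulVec, Matrix.smul_mulVec,
    Matrix.vecMulVec_mulVec, op_smul_eq_smul, smul_smul, div_mul_eq_mul_div]

lemma complexReflection_mulVec_of_orthogonal {w v : n → ℂ} (h : star w ⬝ᵥ v = 0) (z : ℂ) :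
    complexReflection w z *ᵥ v = v := by
  simp [complexReflection_mulVec, h]

lemma complexReflection_mul (w : n → ℂ) (z z' : ℂ) :
    complexReflection w z * complexReflection w z' = complexReflection w (z * z') := by
  rcases eq_or_ne w 0 with rfl | hw
  · simp
  have h := dotProduct_self_ne_zero hw
  simp only [complexReflection, add_mul, mul_add, one_mul, mul_one, smul_mul_assoc,
    mul_smul_comm, Matrix.vecMulVec_mul_vecMulVec, Matrix.vecMulVec_smul, smul_smul]
  match_scalars
  · ring
  · field_simp
    ring

lemma complexReflection_conjTranspose (w : n → ℂ) (z : ℂ) :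
    (complexReflection w z)ᴴ = complexReflection w (star z) := by
  simp [complexReflection, Matrix.conjTranspose_add, Matrix.conjTranspose_smul,
    Matrix.conjTranspose_vecMulVec, star_star_dotProduct]

lemma complexReflection_smul {c : ℂ} (hc : c ≠ 0) (w : n → ℂ) (z : ℂ) :
    complexReflection (c • w) z = complexReflection w z := by
  rcases eq_or_ne w 0 with rfl | hw
  · simp
  have h := dotProduct_self_ne_zero hw
  have hc' : star c ≠ 0 := star_ne_zero.2 hc
  simp only [complexReflection, star_smul, smul_dotProduct, dotProduct_smul,
    Matrix.smul_vecMulVec, Matrix.vecMulVec_smul, smul_smul, smul_eq_mul]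
  congr 2
  field_simp

lemma complexReflection_mem_unitaryGroup (w : n → ℂ) {z : ℂ} (hz : ‖z‖ = 1) :
    complexReflection w z ∈ Matrix.unitaryGroup n ℂ := by
  rw [Matrix.mem_unitaryGroup_iff', Matrix.star_eq_conjTranspose, complexReflection_conjTranspose,
    complexReflection_mul, star_mul_self_of_norm_eq_one hz, complexReflection_one]

lemma unitary_mul_complexReflection_mul {U : Matrix n n ℂ} (hU : U ∈ Matrix.unitaryGroup n ℂ)
    (w : n → ℂ) (z : ℂ) :
    U * complexReflection w z * Uᴴ = complexReflection (U *ᵥ w) z := by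
  have h : U * Uᴴ = 1 := Matrix.mem_unitaryGroup_iff.1 hU
  rw [complexReflection, complexReflection, dotProduct_mulVec_of_mem_unitaryGroup hU]
  simp only [mul_add, add_mul, mul_one, h, mul_smul_comm, smul_mul_assoc, Matrix.mul_vecMulVec,
    Matrix.vecMulVec_mul, Matrix.star_mulVec]

lemma exists_complexReflection_mulVec_eq {a b : n → ℂ} (h : star a ⬝ᵥ a = star b ⬝ᵥ b) :
    ∃ z : ℂ, ‖z‖ = 1 ∧ complexReflection (a - b) z *ᵥ a = b := by
  rcases eq_or_ne a b with rfl | hab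
  · exact ⟨1, by simp, by simp⟩
  set q := star (a - b) ⬝ᵥ a with hq
  have hqq : star (a - b) ⬝ᵥ (a - b) = q + star q := by
    rw [hq, star_star_dotProduct, star_sub, sub_dotProduct, sub_dotProduct, dotProduct_sub,
      dotProduct_sub]
    linear_combination -h
  have hne : q + star q ≠ 0 := hqq ▸ dotProduct_self_ne_zero (sub_ne_zero.2 hab)
  have hq0 : q ≠ 0 := fun h0 => hne (by simp [h0])
  refine ⟨-star q / q, ?_, ?_⟩
  · rw [norm_div, norm_neg, norm_star, div_self (norm_ne_zero_iff.2 hq0)]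
  · have hcoef : (-star q / q - 1) * q / (q + star q) = -1 := by
      field_simp
      ring
    rw [complexReflection_mulVec, ← hq, hqq, hcoef]
    simp

/-- All unitary complex reflections along the direction `w` belong to `H`. -/
def Reflects (H : Submonoid (Matrix n n ℂ)) (w : n → ℂ) : Prop :=
  ∀ z : ℂ, ‖z‖ = 1 → complexReflection w z ∈ H

variable {H : Submonoid (Matrix n n ℂ)}

lemma reflects_zero : Reflects H 0 := fun z _ => by
  rw [complexReflection_zero]
  exact one_mem H

lemma Reflects.smul {w : n → ℂ} (h : Reflects H w) (c : ℂ) : Reflects H (c • w) := by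
  rcases eq_or_ne c 0 with rfl | hc
  · rw [zero_smul]
    exact reflects_zero
  · intro z hz
    rw [complexReflection_smul hc]
    exact h z hz

lemma Reflects.of_smul {w : n → ℂ} {c : ℂ} (hc : c ≠ 0) (h : Reflects H (c • w)) :
    Reflects H w := by
  simpa [smul_smul, hc] using h.smul c⁻¹

lemma Reflects.complexReflection_mulVec {v w : n → ℂ} (hv : Reflects H v) (hw : Reflects H w)
    {z : ℂ} (hz : ‖z‖ = 1) : Reflects H (complexReflection v z *ᵥ w) := fun z' hz' => by
  rw [← unitary_mul_complexReflection_mul (complexReflection_mem_unitaryGroup v hz),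
    complexReflection_conjTranspose]
  exact mul_mem (mul_mem (hv z hz) (hw z' hz')) (hv _ (by rwa [norm_star]))

section Plane

variable {u p : n → ℂ}

lemma Reflects.of_norm_eq (hu : star u ⬝ᵥ u = 1) (hup : star u ⬝ᵥ p = 0) (hHu : Reflects H u)
    {a b a' b' : ℂ} (h : Reflects H (a • u + b • p)) (ha : ‖a‖ = ‖a'‖) (hb : ‖b‖ = ‖b'‖) :
    Reflects H (a' • u + b' • p) := by
  obtain ⟨ζ, hζ, rfl⟩ := exists_phase ha
  obtain ⟨η, hη, rfl⟩ := exists_phase hb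
  have hη0 : η ≠ 0 := norm_ne_zero_iff.1 (hη ▸ one_ne_zero)
  have hζη : ‖ζ / η‖ = 1 := by rw [norm_div, hζ, hη, div_one]
  have hmem := (hHu.complexReflection_mulVec h hζη).smul η
  have hrotated : η • complexReflection u (ζ / η) *ᵥ (a • u + b • p) =
      (ζ * a) • u + (η * b) • p := by
    rw [AKLT.complexReflection_mulVec, hu, dotProduct_add, dotProduct_smul, dotProduct_smul, hu,
      hup]
    match_scalars
    · simp only [smul_eq_mul]
      field_simp
      ring
    · ring
  rwa [hrotated] at hmem

/-- The unit vector in the plane of the orthonormal vectors `u` and `p` whose squared component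
along `u` is `x ∈ [0, 1]`. -/
def latitude (u p : n → ℂ) (x : ℝ) : n → ℂ :=
  (Real.sqrt x : ℂ) • u + (Real.sqrt (1 - x) : ℂ) • p

lemma complexReflection_latitude_mulVec (hu : star u ⬝ᵥ u = 1) (hp : star p ⬝ᵥ p = 1)
    (hup : star u ⬝ᵥ p = 0) {x : ℝ} (hx : x ∈ Set.Icc 0 1) (z : ℂ) :
    complexReflection (latitude u p x) z *ᵥ u =
      (1 + x * (z - 1)) • u + ((z - 1) * Real.sqrt x * Real.sqrt (1 - x)) • p := by
  have hpu : star p ⬝ᵥ u = 0 := by rw [← star_star_dotProduct, hup, star_zero]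
  have hsq : (Real.sqrt x : ℂ) * Real.sqrt x = x := by exact_mod_cast Real.mul_self_sqrt hx.1
  have hsq' : (Real.sqrt (1 - x) : ℂ) * Real.sqrt (1 - x) = 1 - x := by
    exact_mod_cast Real.mul_self_sqrt (sub_nonneg.2 hx.2)
  have hunit : star (latitude u p x) ⬝ᵥ latitude u p x = 1 := by
    simp [latitude, hu, hp, hup, hpu, hsq, hsq']
  have hcomp : star (latitude u p x) ⬝ᵥ u = Real.sqrt x := by
    simp [latitude, hu, hpu]
  rw [complexReflection_mulVec, hunit, hcomp, latitude, ← hsq]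
  module

lemma Reflects.latitude_step (hu : star u ⬝ᵥ u = 1) (hp : star p ⬝ᵥ p = 1)
    (hup : star u ⬝ᵥ p = 0) (hHu : Reflects H u) {x y : ℝ} (hx : x ∈ Set.Icc 0 1)
    (h : Reflects H (latitude u p x)) (hy : y ∈ Set.Icc ((1 - 2 * x) ^ 2) 1) :
    Reflects H (latitude u p y) := by
  have hy0 : 0 ≤ y := (sq_nonneg _).trans hy.1
  have hx' : 0 ≤ x * (1 - x) := mul_nonneg hx.1 (sub_nonneg.2 hx.2)
  obtain ⟨d, hd, hdy⟩ : ∃ d ∈ Set.Icc (0 : ℝ) 4, d * (x * (1 - x)) = 1 - y := by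
    have hle : 1 - y ≤ 4 * (x * (1 - x)) := by linarith [hy.1]
    refine ⟨(1 - y) / (x * (1 - x)), ⟨div_nonneg (sub_nonneg.2 hy.2) hx', ?_⟩, ?_⟩
    · exact div_le_of_le_mul₀ hx' (by norm_num) hle
    · exact div_mul_cancel_of_imp fun h0 => by linarith [hy.2]
  obtain ⟨z, hz, hzd⟩ := exists_norm_sub_one_sq_eq hd
  have hmem := h.complexReflection_mulVec hHu hz
  rw [complexReflection_latitude_mulVec hu hp hup hx] at hmem
  refine Reflects.of_norm_eq hu hup hHu hmem ?_ ?_ <;>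
    rw [← sq_eq_sq₀ (norm_nonneg _) (norm_nonneg _)]
  · rw [norm_one_add_mul_sub_one_sq hz, hzd, hdy, Complex.norm_real, Real.norm_eq_abs, sq_abs,
      Real.sq_sqrt hy0]
    ring
  · simp only [norm_mul, mul_pow, Complex.norm_real, Real.norm_eq_abs, sq_abs, hzd,
      Real.sq_sqrt hx.1, Real.sq_sqrt (sub_nonneg.2 hx.2), Real.sq_sqrt (sub_nonneg.2 hy.2)]
    linear_combination hdy

lemma Icc_zero_one_subset {S : Set ℝ}
    (hS : ∀ x ∈ S, x ∈ Set.Icc 0 1 → Set.Icc ((1 - 2 * x) ^ 2) 1 ⊆ S) {x : ℝ} (hx : x ∈ S)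
    (hx01 : x ∈ Set.Ioo 0 1) : Set.Icc 0 1 ⊆ S := by
  -- As long as `1 / 2 ≤ y`, the length of `[y, 1] ⊆ S` can be doubled.
  have doubling : ∀ (k : ℕ) (y : ℝ), Set.Icc y 1 ⊆ S → 1 ≤ 2 ^ k * (1 - y) →
      Set.Icc 0 1 ⊆ S := by
    intro k
    induction k with
    | zero => exact fun y hy hk => (Set.Icc_subset_Icc_left (by linarith)).trans hy
    | succ k ih =>
      intro y hy hk
      have hy1 : y < 1 := by
        have := pos_of_mul_pos_right (one_pos.trans_le hk) (by positivity)
        linarith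
      rcases le_or_gt y (1 / 2) with hhalf | hhalf
      · simpa using hS (1 / 2) (hy ⟨hhalf, by norm_num⟩) ⟨by norm_num, by norm_num⟩
      · refine ih _ (hS y (hy ⟨le_rfl, hy1.le⟩) ⟨by linarith, hy1.le⟩) (hk.trans ?_)
        rw [pow_succ, mul_assoc]
        gcongr
        nlinarith
  have hlt : 0 < 1 - (1 - 2 * x) ^ 2 := by nlinarith [hx01.1, hx01.2]
  obtain ⟨k, hk⟩ := pow_unbounded_of_one_lt (1 / (1 - (1 - 2 * x) ^ 2)) one_lt_two
  exact doubling k _ (hS x hx ⟨hx01.1.le, hx01.2.le⟩) ((div_le_iff₀ hlt).1 hk.le)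

lemma reflects_latitude_iff (hu : star u ⬝ᵥ u = 1) (hup : star u ⬝ᵥ p = 0) (hHu : Reflects H u)
    {a b : ℂ} (hab : 0 < ‖a‖ ^ 2 + ‖b‖ ^ 2) :
    Reflects H (latitude u p (‖a‖ ^ 2 / (‖a‖ ^ 2 + ‖b‖ ^ 2))) ↔ Reflects H (a • u + b • p) := by
  set r := ‖a‖ ^ 2 + ‖b‖ ^ 2
  have hr : (Real.sqrt r : ℂ) ≠ 0 := by exact_mod_cast (Real.sqrt_pos.2 hab).ne'
  have hscale : ∀ c : ℂ, ‖(Real.sqrt (‖c‖ ^ 2 / r) : ℂ)‖ = ‖(Real.sqrt r : ℂ)⁻¹ * c‖ := by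
    intro c
    rw [Complex.norm_real, Real.norm_eq_abs, abs_of_nonneg (Real.sqrt_nonneg _), norm_mul,
      norm_inv, Complex.norm_real, Real.norm_eq_abs, abs_of_nonneg (Real.sqrt_nonneg _),
      Real.sqrt_div (sq_nonneg _), Real.sqrt_sq (norm_nonneg _), div_eq_inv_mul]
  have hlat : latitude u p (‖a‖ ^ 2 / r) =
      (Real.sqrt (‖a‖ ^ 2 / r) : ℂ) • u + (Real.sqrt (‖b‖ ^ 2 / r) : ℂ) • p := by
    rw [latitude, one_sub_div hab.ne', add_sub_cancel_left]
  have hsmul : a • u + b • p = (Real.sqrt r : ℂ) •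
      (((Real.sqrt r : ℂ)⁻¹ * a) • u + ((Real.sqrt r : ℂ)⁻¹ * b) • p) := by
    simp only [smul_add, smul_smul, mul_inv_cancel_left₀ hr]
  rw [hlat, hsmul]
  exact ⟨fun h => (Reflects.of_norm_eq hu hup hHu h (hscale a) (hscale b)).smul _,
    fun h => Reflects.of_norm_eq hu hup hHu (h.of_smul hr) (hscale a).symm (hscale b).symm⟩

lemma Reflects.plane (hu : star u ⬝ᵥ u = 1) (hp : star p ⬝ᵥ p = 1) (hup : star u ⬝ᵥ p = 0)
    (hHu : Reflects H u) {a b : ℂ} (ha : a ≠ 0) (hb : b ≠ 0) (h : Reflects H (a • u + b • p))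
    (a' b' : ℂ) : Reflects H (a' • u + b' • p) := by
  have hb2 : 0 < ‖b‖ ^ 2 := by positivity
  have hall : Set.Icc 0 1 ⊆ {x | Reflects H (latitude u p x)} :=
    Icc_zero_one_subset (fun x h hx y hy => hHu.latitude_step hu hp hup hx h hy)
      ((reflects_latitude_iff hu hup hHu (by positivity)).2 h)
      ⟨by positivity, (div_lt_one (by positivity)).2 (by linarith)⟩
  rcases (by positivity : 0 ≤ ‖a'‖ ^ 2 + ‖b'‖ ^ 2).eq_or_lt with h0 | hpos
  · have ha0 : a' = 0 := by simpa using (by nlinarith : ‖a'‖ ^ 2 = 0)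
    have hb0 : b' = 0 := by simpa using (by nlinarith : ‖b'‖ ^ 2 = 0)
    simpa [ha0, hb0] using reflects_zero
  · refine (reflects_latitude_iff hu hup hHu hpos).1 (hall ⟨by positivity, ?_⟩)
    exact (div_le_one hpos).2 (le_add_of_nonneg_right (sq_nonneg _))

end Plane

lemma Reflects.add_smul {u w : n → ℂ} (hu : Reflects H u) (hw : Reflects H w)
    (huw : star u ⬝ᵥ w ≠ 0) (t : ℂ) : Reflects H (w + t • u) := by
  have hu0 : u ≠ 0 := by rintro rfl; simp at huw
  obtain ⟨c, e, hc, he, rfl⟩ := exists_smul_unit_eq hu0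
  have hHe := hu.of_smul hc
  obtain ⟨a, q, hq⟩ : ∃ a q, q = w - a • e ∧ a = star e ⬝ᵥ w := ⟨_, _, rfl, rfl⟩
  have ha : a ≠ 0 := by
    rintro rfl
    simp [← hq.2] at huw
  have heq : star e ⬝ᵥ q = 0 := by simp [hq.1, he, ← hq.2]
  obtain rfl : w = a • e + q := by simp [hq.1]
  rcases eq_or_ne q 0 with rfl | hq0
  · rw [add_zero, smul_smul, ← _root_.add_smul]
    exact hHe.smul _
  · obtain ⟨b, p, hb, hp, rfl⟩ := exists_smul_unit_eq hq0
    have hep : star e ⬝ᵥ p = 0 := by simpa [hb] using heq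
    have hform : a • e + b • p + t • c • e = (a + t * c) • e + b • p := by module
    rw [hform]
    exact Reflects.plane he hp hep hHe ha hb hw _ _

lemma Reflects.of_single_of_one (hs : ∀ i, Reflects H (Pi.single i 1)) (h1 : Reflects H (1 : n → ℂ))
    (t : n → ℂ) : Reflects H t := by
  suffices main : ∀ s : Finset n, Reflects H (s.piecewise t 1) by
    simpa using main Finset.univ
  intro s
  induction s using Finset.induction_on with
  | empty => simpa using h1
  | insert i s hi ih =>
    have hform : (insert i s).piecewise t 1 =
        s.piecewise t 1 + (t i - 1) • (Pi.single i 1 : n → ℂ) := by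
      ext j
      rcases eq_or_ne j i with rfl | hj
      · simp [hi]
      · simp [hj, Finset.piecewise]
    rw [hform]
    exact (hs i).add_smul ih (by simp [hi]) _

lemma unitary_mem_of_reflects (h : ∀ w, Reflects H w) {U : Matrix n n ℂ}
    (hU : U ∈ Matrix.unitaryGroup n ℂ) : U ∈ H := by
  suffices main : ∀ s : Finset n, ∀ U ∈ Matrix.unitaryGroup n ℂ,
      (∀ i ∉ s, U *ᵥ Pi.single i 1 = Pi.single i 1) → U ∈ H from
    main Finset.univ U hU (by simp)
  intro s
  induction s using Finset.induction_on with
  | empty =>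
    intro U _ hfix
    have hone : U = 1 := Matrix.ext_of_mulVec_single fun i => by
      rw [hfix i (by simp), Matrix.one_mulVec]
    exact hone ▸ one_mem H
  | insert i s hi ih =>
    intro U hU hfix
    set w := U *ᵥ Pi.single i 1 - Pi.single i 1 with hw
    obtain ⟨z, hz, hzU⟩ := exists_complexReflection_mulVec_eq
      (dotProduct_mulVec_of_mem_unitaryGroup hU (Pi.single i 1) (Pi.single i 1))
    have hmem : complexReflection w z * U ∈ H := by
      refine ih _ (mul_mem (complexReflection_mem_unitaryGroup w hz) hU) fun j hj => ?_
      rw [← Matrix.mulVec_mulVec]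
      rcases eq_or_ne j i with rfl | hji
      · exact hzU
      · have hUj := hfix j (by simp [hji, hj])
        have horth : star w ⬝ᵥ Pi.single j 1 = 0 := by
          have hinner := dotProduct_mulVec_of_mem_unitaryGroup hU (Pi.single i 1) (Pi.single j 1)
          rw [hUj] at hinner
          rw [hw, star_sub, sub_dotProduct, hinner, sub_self]
        rw [hUj, complexReflection_mulVec_of_orthogonal horth]
    have hcancel : complexReflection w (star z) * (complexReflection w z * U) = U := by
      rw [← mul_assoc, complexReflection_mul, star_mul_self_of_norm_eq_one hz,
        complexReflection_one, one_mul]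
    rw [← hcancel]
    exact mul_mem (h w _ (by rwa [norm_star])) hmem

end Matrices

end Reflections

section HeisenbergWeyl

open scoped Fin.CommRing

section Algebra

variable {N : ℕ} [NeZero N]

/-- The character `m ↦ ω ^ m` of `ℤ / N`, realized on the index type `Fin N`. -/
def rootCharacter (N : ℕ) [NeZero N] : AddChar (Fin N) ℂ where
  toFun m := Complex.exp (2 * Real.pi * Complex.I / N) ^ m.val
  map_zero_eq_one' := by simp
  map_add_eq_mul' a b := by
    rw [Fin.val_add, ← pow_add,
      ← pow_eq_pow_mod _ (Complex.isPrimitiveRoot_exp N (NeZero.ne N)).pow_eq_one]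

lemma rootCharacter_eq_one_iff {m : Fin N} : rootCharacter N m = 1 ↔ m = 0 := by
  refine ⟨fun h => ?_, fun h => by rw [h, AddChar.map_zero_eq_one]⟩
  have hdvd := (Complex.isPrimitiveRoot_exp N (NeZero.ne N)).dvd_of_pow_eq_one m.val h
  exact Fin.val_eq_zero_iff.1 (Nat.eq_zero_of_dvd_of_lt hdvd m.isLt)

lemma rootCharacter_ne_zero (m : Fin N) : rootCharacter N m ≠ 0 :=
  norm_ne_zero_iff.1 (by rw [AddChar.norm_apply]; exact one_ne_zero)

lemma rootCharacter_injective : Function.Injective (rootCharacter N) := fun a b h =>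
  sub_eq_zero.1 <| rootCharacter_eq_one_iff.1 <| by
    rw [AddChar.map_sub_eq_div, h, div_self (rootCharacter_ne_zero b)]

lemma rootCharacter_isPrimitive : (rootCharacter N).IsPrimitive := fun a ha h =>
  ha <| rootCharacter_eq_one_iff.1 <| by simpa using DFunLike.congr_fun h 1

lemma star_rootCharacter (m : Fin N) : star (rootCharacter N m) = rootCharacter N (-m) :=
  (AddChar.map_neg_eq_conj _ _).symm

lemma shiftX_pow_apply (k : ℕ) (a b : Fin N) :
    (shiftX N ^ k) a b = if b = a + (k : Fin N) then 1 else 0 := by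
  have hshift : ∀ a b : Fin N, shiftX N a b = if b = a + 1 then 1 else 0 := fun a b => by
    simp [shiftX, Fin.ext_iff, Fin.val_add]
  induction k generalizing b with
  | zero => simp [Matrix.one_apply, eq_comm]
  | succ k ih =>
    simp only [pow_succ, Matrix.mul_apply, ih, hshift, ite_mul, one_mul, zero_mul,
      Finset.sum_ite_eq', Finset.mem_univ, if_true, Nat.cast_succ, add_assoc]

lemma hw_apply (p : Fin N × Fin N) (a b : Fin N) :
    hw N p a b = if b = a + p.1 then rootCharacter N (b * p.2) else 0 := by
  have hclock : (Complex.exp (2 * Real.pi * Complex.I / N) ^ b.val) ^ p.2.val =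
      rootCharacter N (b * p.2) := by
    have h := AddChar.map_nsmul_eq_pow (rootCharacter N) p.2.val b
    rw [nsmul_eq_mul, Fin.cast_val_eq_self, mul_comm] at h
    exact h.symm
  simp [hw, clockZ, Matrix.diagonal_pow, Matrix.mul_diagonal, shiftX_pow_apply, hclock]

lemma hw_mulVec_apply (p : Fin N × Fin N) (v : Fin N → ℂ) (a : Fin N) :
    (hw N p *ᵥ v) a = rootCharacter N ((a + p.1) * p.2) * v (a + p.1) := by
  simp [Matrix.mulVec, dotProduct, hw_apply]

lemma hw_zero : hw N (0 : Fin N × Fin N) = 1 := by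
  simp [hw]

lemma hw_mul (p q : Fin N × Fin N) :
    hw N p * hw N q = rootCharacter N (-(p.2 * q.1)) • hw N (p + q) := by
  refine Matrix.ext_of_mulVec_single fun i => funext fun a => ?_
  rw [← Matrix.mulVec_mulVec, hw_mulVec_apply, hw_mulVec_apply, Matrix.smul_mulVec, Pi.smul_apply,
    hw_mulVec_apply, smul_eq_mul, ← mul_assoc, ← mul_assoc, ← AddChar.map_add_eq_mul,
    ← AddChar.map_add_eq_mul, Prod.fst_add, Prod.snd_add, add_assoc a]
  congr 2
  ring

lemma hw_conjTranspose (p : Fin N × Fin N) :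
    (hw N p)ᴴ = rootCharacter N (-(p.1 * p.2)) • hw N (-p) := by
  ext a b
  rw [Matrix.conjTranspose_apply, Matrix.smul_apply, hw_apply, hw_apply]
  rcases eq_or_ne a (b + p.1) with rfl | hab
  · simp only [Prod.fst_neg, Prod.snd_neg, add_neg_cancel_right, if_true, star_rootCharacter,
      smul_eq_mul, ← AddChar.map_add_eq_mul]
    congr 1
    ring
  · have hba : b ≠ a + -p.1 := fun h => hab (by rw [h]; ring)
    simp [hab, hba]

lemma hw_conjTranspose_mul (p q : Fin N × Fin N) :
    (hw N p)ᴴ * hw N q = rootCharacter N (p.2 * (q.1 - p.1)) • hw N (q - p) := by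
  rw [hw_conjTranspose, smul_mul_assoc, hw_mul, smul_smul, ← AddChar.map_add_eq_mul,
    neg_add_eq_sub p q]
  congr 2
  simp only [Prod.snd_neg]
  ring

lemma hw_mem_unitaryGroup (p : Fin N × Fin N) : hw N p ∈ Matrix.unitaryGroup (Fin N) ℂ := by
  rw [Matrix.mem_unitaryGroup_iff', Matrix.star_eq_conjTranspose, hw_conjTranspose_mul]
  simp [hw_zero]

lemma hw_conjTranspose_mul_self (p : Fin N × Fin N) : (hw N p)ᴴ * hw N p = 1 :=
  Matrix.mem_unitaryGroup_iff'.1 (hw_mem_unitaryGroup p)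

lemma hw_mul_conjTranspose_self (p : Fin N × Fin N) : hw N p * (hw N p)ᴴ = 1 :=
  Matrix.mem_unitaryGroup_iff.1 (hw_mem_unitaryGroup p)

lemma trace_hw (r : Fin N × Fin N) : (hw N r).trace = if r = 0 then (N : ℂ) else 0 := by
  have hdiag : (hw N r).trace = if r.1 = 0 then ∑ a, rootCharacter N (a * r.2) else 0 := by
    simp only [Matrix.trace, Matrix.diag_apply, hw_apply, left_eq_add]
    split_ifs <;> simp
  rw [hdiag, AddChar.sum_mulShift _ rootCharacter_isPrimitive]
  simp [Prod.ext_iff, ite_and]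

lemma trace_hw_conjTranspose_mul (p q : Fin N × Fin N) :
    ((hw N p)ᴴ * hw N q).trace = if p = q then (N : ℂ) else 0 := by
  rw [hw_conjTranspose_mul, Matrix.trace_smul, trace_hw]
  rcases eq_or_ne p q with rfl | hpq
  · simp
  · rw [if_neg (sub_ne_zero.2 hpq.symm), if_neg hpq, smul_zero]

/-- The symplectic form of the phase space `(ℤ / N)²`, which governs the commutation of the
Heisenberg–Weyl operators. -/
def symplecticForm (p q : Fin N × Fin N) : Fin N :=
  p.1 * q.2 - p.2 * q.1

/-- The phase by which the Heisenberg–Weyl operators of `p` and `q` fail to commute. -/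
def weylPhase (p q : Fin N × Fin N) : ℂ :=
  rootCharacter N (symplecticForm p q)

lemma hw_mul_comm (p q : Fin N × Fin N) :
    hw N p * hw N q = weylPhase p q • (hw N q * hw N p) := by
  rw [hw_mul, hw_mul, weylPhase, symplecticForm, smul_smul, ← AddChar.map_add_eq_mul, add_comm q p]
  congr 2
  ring

lemma exists_hw_nsmul (p : Fin N × Fin N) (m : ℕ) :
    ∃ c : ℂ, hw N (m • p) = c • hw N p ^ m := by
  induction m with
  | zero => exact ⟨1, by simp [hw_zero]⟩
  | succ m ih =>
    obtain ⟨c, hc⟩ := ih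
    refine ⟨(rootCharacter N (-((m • p).2 * p.1)))⁻¹ * c, ?_⟩
    rw [pow_succ, ← smul_smul, ← smul_mul_assoc, ← hc, hw_mul, succ_nsmul,
      inv_smul_smul₀ (rootCharacter_ne_zero _)]

end Algebra

section Axes

variable {N : ℕ} [NeZero N]

/-- The operators `X` and `XʲZ` are those with labels `(1, 0)` and `(j, 1)`. -/
def IsAxis (a : Fin N × Fin N) : Prop :=
  a = (1, 0) ∨ a.2 = 1

lemma IsAxis.weylPhase_eq_one_iff {a : Fin N × Fin N} (ha : IsAxis a) (q : Fin N × Fin N) :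
    weylPhase a q = 1 ↔ ∃ m : Fin N, m • a = q := by
  rw [weylPhase, rootCharacter_eq_one_iff, symplecticForm, sub_eq_zero]
  obtain ⟨q₁, q₂⟩ := q
  rcases ha with rfl | ha
  · refine ⟨fun h => ⟨q₁, ?_⟩, ?_⟩
    · have hq₂ : q₂ = 0 := by simpa using h
      simp [hq₂]
    · rintro ⟨m, hm⟩
      simpa [eq_comm] using (Prod.ext_iff.1 hm).2
  · refine ⟨fun h => ⟨q₂, ?_⟩, ?_⟩
    · ext1
      · simpa [ha, mul_comm] using h
      · simp [ha]
    · rintro ⟨m, hm⟩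
      simp [Prod.ext_iff, ha] at hm
      simp [← hm.1, ← hm.2, ha, mul_comm]

lemma IsAxis.exists_symplecticForm_eq {a : Fin N × Fin N} (ha : IsAxis a) {m : Fin N}
    (hm : m ≠ 0) : ∃ α : Label N, symplecticForm a α.1 = m := by
  rcases ha with rfl | ha
  · exact ⟨⟨(0, m), by simpa [Fin.val_eq_zero_iff] using hm⟩, by simp [symplecticForm]⟩
  · exact ⟨⟨(-m, 0), by simpa [Fin.val_eq_zero_iff] using hm⟩, by simp [symplecticForm, ha]⟩

lemma IsAxis.smul_injective {a : Fin N × Fin N} (ha : IsAxis a) :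
    Function.Injective fun m : Fin N => m • a := by
  intro m m' h
  rcases ha with rfl | ha
  · simpa using (Prod.ext_iff.1 h).1
  · simpa [ha] using (Prod.ext_iff.1 h).2

lemma IsAxis.card_weylPhase_eq_one {a : Fin N × Fin N} (ha : IsAxis a) :
    Finset.card {q | weylPhase a q = 1} = N := by
  have hset : ({q | weylPhase a q = 1} : Finset (Fin N × Fin N)) =
      Finset.univ.image fun m : Fin N => m • a := by
    ext q
    simp [ha.weylPhase_eq_one_iff]
  rw [hset, Finset.card_image_of_injective _ ha.smul_injective, Finset.card_fin]

lemma mem_axisOperators_iff {N : ℕ} [N.AtLeastTwo] {O : Matrix (Fin N) (Fin N) ℂ} :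
    O ∈ axisOperators N ↔ ∃ a, IsAxis a ∧ O = hw N a := by
  have hone : 1 % N = 1 := Nat.mod_eq_of_lt Nat.AtLeastTwo.one_lt
  constructor
  · rintro (rfl | ⟨j, rfl⟩)
    · exact ⟨(1, 0), Or.inl rfl, by simp [hw, hone]⟩
    · exact ⟨(j, 1), Or.inr rfl, by simp [hw, hone]⟩
  · rintro ⟨⟨j, k⟩, ha | rfl, rfl⟩
    · obtain ⟨rfl, rfl⟩ := Prod.ext_iff.1 ha
      exact Or.inl (by simp [hw, hone])
    · exact Or.inr ⟨j, by simp [hw, hone]⟩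

end Axes

end HeisenbergWeyl

section ElementaryGates

open scoped Fin.CommRing

lemma exp_smul_of_isIdempotentElem {n : Type*} [Fintype n] [DecidableEq n] {P : Matrix n n ℂ}
    (hP : IsIdempotentElem P) (t : ℂ) :
    NormedSpace.exp (t • P) = 1 + (Complex.exp t - 1) • P := by
  have hexp : HasSum (fun k : ℕ => ((k.factorial : ℂ)⁻¹ * t ^ k) • P) (Complex.exp t • P) := by
    refine HasSum.smul_const ?_ P
    simpa only [Complex.exp_eq_exp_ℂ, smul_eq_mul] using
      NormedSpace.exp_series_hasSum_exp' (𝕂 := ℂ) t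
  have hterm : (fun k : ℕ => ((k.factorial : ℂ)⁻¹ * t ^ k) • P + if k = 0 then 1 - P else 0) =
      fun k : ℕ => (k.factorial : ℂ)⁻¹ • (t • P) ^ k := by
    ext1 k
    rcases eq_or_ne k 0 with rfl | hk
    · simp
    · rw [if_neg hk, add_zero, smul_pow, hP.pow_eq hk, smul_smul]
  have hsum := hexp.add (hasSum_ite_eq 0 (1 - P))
  rw [hterm] at hsum
  rw [NormedSpace.exp_eq_tsum ℂ]
  refine hsum.tsum_eq.trans ?_
  rw [sub_smul, one_smul]
  abel

lemma exp_smul_vecMulVec {n : Type*} [Fintype n] [DecidableEq n] {v : n → ℂ}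
    (hv : star v ⬝ᵥ v = 1) (t : ℂ) :
    NormedSpace.exp (t • Matrix.vecMulVec v (star v)) = complexReflection v (Complex.exp t) := by
  rw [exp_smul_of_isIdempotentElem, complexReflection, hv, div_one]
  rw [IsIdempotentElem, Matrix.vecMulVec_mul_vecMulVec, hv, one_smul]

lemma isElementaryGate_iff {N : ℕ} [N.AtLeastTwo] {V : Matrix (Fin N) (Fin N) ℂ} :
    IsElementaryGate N V ↔ ∃ a, IsAxis a ∧ ∃ (v : Fin N → ℂ) (μ z : ℂ),
      v ≠ 0 ∧ ‖z‖ = 1 ∧ hw N a *ᵥ v = μ • v ∧ V = complexReflection v z := by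
  constructor
  · rintro ⟨O, hO, v, μ, θ, hv, hOv, rfl⟩
    obtain ⟨a, ha, rfl⟩ := mem_axisOperators_iff.1 hO
    have hunit : star v ⬝ᵥ v = 1 := by rw [star_dotProduct_self_eq_sum, hv, Complex.ofReal_one]
    refine ⟨a, ha, v, μ, Complex.exp (Complex.I * θ), ?_, ?_, hOv, exp_smul_vecMulVec hunit _⟩
    · rintro rfl
      simp at hunit
    · rw [mul_comm, Complex.norm_exp_ofReal_mul_I]
  · rintro ⟨a, ha, v, μ, z, hv, hz, hav, rfl⟩
    obtain ⟨c, e, hc, he, rfl⟩ := exists_smul_unit_eq hv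
    have hexp : Complex.exp (Complex.I * z.arg) = z := by
      simpa [hz, mul_comm] using Complex.norm_mul_exp_arg_mul_I z
    refine ⟨_, mem_axisOperators_iff.2 ⟨a, ha, rfl⟩, e, μ, z.arg, ?_, ?_, ?_⟩
    · exact_mod_cast (star_dotProduct_self_eq_sum e).symm.trans he
    · rwa [Matrix.mulVec_smul, smul_comm, smul_right_inj hc] at hav
    · rw [exp_smul_vecMulVec he, complexReflection_smul hc, hexp]

lemma commute_complexReflection_iff {n : Type*} [Fintype n] [DecidableEq n] {v : n → ℂ}
    (hv : v ≠ 0) {z : ℂ} (hz : z ≠ 1) {U : Matrix n n ℂ} (hU : U ∈ Matrix.unitaryGroup n ℂ) :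
    Commute (complexReflection v z) U ↔ ∃ c : ℂ, c ≠ 0 ∧ U *ᵥ v = c • v := by
  have hUU : Uᴴ * U = 1 := Matrix.mem_unitaryGroup_iff'.1 hU
  constructor
  · intro h
    have hfix : complexReflection v z *ᵥ v = z • v := by
      rw [complexReflection_mulVec, mul_div_cancel_right₀ _ (dotProduct_self_ne_zero hv), sub_smul,
        one_smul, add_sub_cancel]
    have heigen : complexReflection v z *ᵥ (U *ᵥ v) = z • (U *ᵥ v) := by
      rw [Matrix.mulVec_mulVec, h.eq, ← Matrix.mulVec_mulVec, hfix, Matrix.mulVec_smul]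
    have hsub : z • (U *ᵥ v) - U *ᵥ v = (z - 1) • (U *ᵥ v) := by rw [sub_smul, one_smul]
    rw [complexReflection_mulVec, mul_div_assoc, ← smul_smul, ← eq_sub_iff_add_eq', hsub,
      smul_right_inj (sub_ne_zero.2 hz)] at heigen
    refine ⟨_, fun hc => hv ?_, heigen.symm⟩
    rw [hc, zero_smul] at heigen
    rw [← Matrix.one_mulVec v, ← hUU, ← Matrix.mulVec_mulVec, ← heigen, Matrix.mulVec_zero]
  · rintro ⟨c, hc, hUv⟩
    have hconj := unitary_mul_complexReflection_mul hU v z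
    rw [hUv, complexReflection_smul hc] at hconj
    rw [Commute, SemiconjBy]
    conv_lhs => rw [← hconj, mul_assoc, hUU, mul_one]

lemma trace_complexReflection {n : Type*} [Fintype n] [DecidableEq n] {v : n → ℂ} (hv : v ≠ 0)
    (z : ℂ) : (complexReflection v z).trace = Fintype.card n + (z - 1) := by
  rw [complexReflection, Matrix.trace_add, Matrix.trace_one, Matrix.trace_smul,
    Matrix.trace_vecMulVec, dotProduct_comm v, smul_eq_mul,
    div_mul_cancel₀ _ (dotProduct_self_ne_zero hv)]

section InducedGate

variable {N : ℕ} [NeZero N] {V : Matrix (Fin N) (Fin N) ℂ}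

lemma hw_mulVec_hw_mulVec {a p : Fin N × Fin N} {v : Fin N → ℂ} {μ : ℂ}
    (hv : hw N a *ᵥ v = μ • v) :
    hw N a *ᵥ (hw N p *ᵥ v) = (weylPhase a p * μ) • (hw N p *ᵥ v) := by
  rw [Matrix.mulVec_mulVec, hw_mul_comm, Matrix.smul_mulVec, ← Matrix.mulVec_mulVec, hv,
    Matrix.mulVec_smul, smul_smul]

lemma hw_mulVec_ne_zero (p : Fin N × Fin N) {v : Fin N → ℂ} (hv : v ≠ 0) :
    hw N p *ᵥ v ≠ 0 := fun h => hv <| by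
  rw [← Matrix.one_mulVec v, ← hw_conjTranspose_mul_self p, ← Matrix.mulVec_mulVec, h,
    Matrix.mulVec_zero]

lemma hw_mul_inducedGate (V : Matrix (Fin N) (Fin N) ℂ) (α : Label N) :
    hw N α.1 * inducedGate N V α = Vᴴ * hw N α.1 * V := by
  simp only [inducedGate, ← mul_assoc, hw_mul_conjTranspose_self, one_mul]

lemma inducedGate_mem_specialUnitaryGroup (hV : V ∈ Matrix.unitaryGroup (Fin N) ℂ) (α : Label N) :
    inducedGate N V α ∈ Matrix.specialUnitaryGroup (Fin N) ℂ := by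
  have hW := hw_mem_unitaryGroup α.1
  have hdetV : Vᴴ.det * V.det = 1 := by
    rw [← Matrix.det_mul, ← Matrix.star_eq_conjTranspose, Matrix.mem_unitaryGroup_iff'.1 hV,
      Matrix.det_one]
  have hdetW : (hw N α.1)ᴴ.det * (hw N α.1).det = 1 := by
    rw [← Matrix.det_mul, hw_conjTranspose_mul_self, Matrix.det_one]
  refine Matrix.mem_specialUnitaryGroup_iff.2
    ⟨mul_mem (mul_mem (mul_mem (Unitary.star_mem hW) (Unitary.star_mem hV)) hW) hV, ?_⟩
  simp only [inducedGate, Matrix.det_mul]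
  linear_combination Vᴴ.det * V.det * hdetW + hdetV

lemma inducedGate_eq_one_iff_commute (hV : V ∈ Matrix.unitaryGroup (Fin N) ℂ) (α : Label N) :
    inducedGate N V α = 1 ↔ Commute V (hw N α.1) := by
  have hVV : V * Vᴴ = 1 := Matrix.mem_unitaryGroup_iff.1 hV
  have hVV' : Vᴴ * V = 1 := Matrix.mem_unitaryGroup_iff'.1 hV
  refine ⟨fun h => ?_, fun h => ?_⟩
  · have hpull := hw_mul_inducedGate V α
    rw [h, mul_one] at hpull
    rw [Commute, SemiconjBy]
    conv_lhs => rw [hpull, mul_assoc, ← mul_assoc, hVV, one_mul]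
  · rw [inducedGate, mul_assoc, ← h.eq, mul_assoc, ← mul_assoc Vᴴ, hVV', one_mul,
      hw_conjTranspose_mul_self]

lemma inducedGate_complexReflection_eq_one_iff {a : Fin N × Fin N} (ha : IsAxis a)
    {v : Fin N → ℂ} (hv : v ≠ 0) {μ z : ℂ} (hav : hw N a *ᵥ v = μ • v) (hz : ‖z‖ = 1)
    (hz1 : z ≠ 1) (α : Label N) :
    inducedGate N (complexReflection v z) α = 1 ↔ weylPhase a α.1 = 1 := by
  have hμ : μ ≠ 0 := by
    rintro rfl
    exact hw_mulVec_ne_zero a hv (by rw [hav, zero_smul])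
  rw [inducedGate_eq_one_iff_commute (complexReflection_mem_unitaryGroup v hz),
    commute_complexReflection_iff hv hz1 (hw_mem_unitaryGroup α.1)]
  constructor
  · rintro ⟨c, hc, hαv⟩
    have h := hw_mulVec_hw_mulVec (p := α.1) hav
    rw [hαv, Matrix.mulVec_smul, hav, smul_comm c] at h
    exact (mul_eq_right₀ hμ).1 (smul_left_injective ℂ (smul_ne_zero hc hv) h.symm)
  · intro h
    obtain ⟨m, hm⟩ := (ha.weylPhase_eq_one_iff α.1).1 h
    obtain ⟨c, hc⟩ := exists_hw_nsmul a m.val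
    rw [← Nat.cast_smul_eq_nsmul (Fin N), Fin.cast_val_eq_self, hm] at hc
    have hpow : ∀ k : ℕ, hw N a ^ k *ᵥ v = μ ^ k • v := fun k => by
      induction k with
      | zero => simp
      | succ k ih =>
        rw [pow_succ, ← Matrix.mulVec_mulVec, hav, Matrix.mulVec_smul, ih, smul_smul, ← pow_succ']
    have hαv : hw N α.1 *ᵥ v = (c * μ ^ m.val) • v := by
      rw [hc, Matrix.smul_mulVec, hpow, smul_smul]
    refine ⟨_, fun h0 => hw_mulVec_ne_zero α.1 hv ?_, hαv⟩
    rw [hαv, h0, zero_smul]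

end InducedGate

section Elementary

variable {N : ℕ} [N.AtLeastTwo] {V : Matrix (Fin N) (Fin N) ℂ}

lemma isElementaryGate_one : IsElementaryGate N 1 := by
  refine isElementaryGate_iff.2 ⟨(0, 1), Or.inr rfl, Pi.single 0 1, 1, 1, by simp, by simp,
    funext fun a => ?_, by simp⟩
  rcases eq_or_ne a 0 with rfl | ha <;> simp [hw_mulVec_apply, *]

lemma IsElementaryGate.mem_unitaryGroup (hV : IsElementaryGate N V) :
    V ∈ Matrix.unitaryGroup (Fin N) ℂ := by
  obtain ⟨a, -, v, μ, z, -, hz, -, rfl⟩ := isElementaryGate_iff.1 hV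
  exact complexReflection_mem_unitaryGroup v hz

lemma IsElementaryGate.hw_mul_mul_conjTranspose (hV : IsElementaryGate N V)
    (p : Fin N × Fin N) : IsElementaryGate N (hw N p * V * (hw N p)ᴴ) := by
  obtain ⟨a, ha, v, μ, z, hv, hz, hav, rfl⟩ := isElementaryGate_iff.1 hV
  exact isElementaryGate_iff.2 ⟨a, ha, hw N p *ᵥ v, weylPhase a p * μ, z, hw_mulVec_ne_zero _ hv,
    hz, hw_mulVec_hw_mulVec hav, unitary_mul_complexReflection_mul (hw_mem_unitaryGroup p) v z⟩

lemma IsElementaryGate.trace_ne_zero (hV : IsElementaryGate N V) (h : 2 < N ∨ V * V ≠ 1) :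
    V.trace ≠ 0 := by
  obtain ⟨a, -, v, μ, z, hv, hz, -, rfl⟩ := isElementaryGate_iff.1 hV
  rw [trace_complexReflection hv, Fintype.card_fin]
  intro h0
  have hN2 : (2 : ℝ) ≤ N := Nat.ofNat_le_cast.2 Nat.AtLeastTwo.prop
  have hz' : z = ((1 - N : ℝ) : ℂ) := by
    push_cast
    linear_combination h0
  have hN : (N : ℝ) = 2 := by
    rw [hz', Complex.norm_real, Real.norm_of_nonpos (by linarith)] at hz
    linarith
  rcases h with h | h
  · exact h.ne' (by exact_mod_cast hN)
  · rw [complexReflection_mul, hz', hN] at h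
    norm_num at h

lemma IsElementaryGate.inducedGate_ne_smul_one (hV : IsElementaryGate N V)
    (h : 2 < N ∨ V * V ≠ 1) {α : Label N} (hne : inducedGate N V α ≠ 1) (s : ℂ) :
    inducedGate N V α ≠ s • 1 := by
  intro hs
  have hVV : V * Vᴴ = 1 := Matrix.mem_unitaryGroup_iff.1 hV.mem_unitaryGroup
  have hconj : (hw N α.1)ᴴ * Vᴴ * hw N α.1 = s • Vᴴ := by
    rw [← one_mul Vᴴ, ← smul_mul_assoc, ← hs, inducedGate, mul_assoc _ V, hVV, mul_one, one_mul]
  have htrace := congrArg Matrix.trace hconj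
  rw [Matrix.trace_mul_comm, ← mul_assoc, hw_mul_conjTranspose_self, one_mul,
    Matrix.trace_conjTranspose, Matrix.trace_smul, Matrix.trace_conjTranspose,
    smul_eq_mul] at htrace
  have hs1 : s = 1 := (mul_eq_right₀ (star_ne_zero.2 (hV.trace_ne_zero h))).1 htrace.symm
  exact hne (by rw [hs, hs1, one_smul])

lemma card_label (N : ℕ) [NeZero N] : Fintype.card (Label N) = N ^ 2 - 1 := by
  have hzero : ∀ p : Fin N × Fin N, (p.1.val = 0 ∧ p.2.val = 0) ↔ p = 0 := fun p => by
    simp [Prod.ext_iff, Fin.val_eq_zero_iff]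
  rw [Fintype.card_subtype_compl, Fintype.card_congr (Equiv.subtypeEquivRight hzero)]
  simp [sq]

lemma cast_card_label (N : ℕ) [NeZero N] : (Fintype.card (Label N) : ℝ) = (N : ℝ) ^ 2 - 1 := by
  rw [card_label, Nat.cast_sub (Nat.one_le_pow _ _ (NeZero.pos N)), Nat.cast_pow, Nat.cast_one]

instance : Nonempty (Label N) := by
  refine Fintype.card_pos_iff.1 ?_
  rw [card_label, tsub_pos_iff_lt]
  exact Nat.one_lt_pow two_ne_zero Nat.AtLeastTwo.prop

open Classical in
lemma IsElementaryGate.card_inducedGate_eq_one (hV : IsElementaryGate N V) (hV1 : V ≠ 1) :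
    Finset.card {α : Label N | inducedGate N V α = 1} = N - 1 := by
  obtain ⟨a, ha, v, μ, z, hv, hz, hav, rfl⟩ := isElementaryGate_iff.1 hV
  have hz1 : z ≠ 1 := by
    rintro rfl
    exact hV1 (complexReflection_one v)
  have hmap : ({α : Label N | inducedGate N (complexReflection v z) α = 1} : Finset _).map
      (Function.Embedding.subtype _) =
        ({q | weylPhase a q = 1} : Finset (Fin N × Fin N)).erase 0 := by
    ext q
    simp [inducedGate_complexReflection_eq_one_iff ha hv hav hz hz1, Prod.ext_iff,
      Fin.val_eq_zero_iff, and_comm]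
  rw [← Finset.card_map, hmap, Finset.card_erase_of_mem, ha.card_weylPhase_eq_one]
  exact Finset.mem_filter.2 ⟨Finset.mem_univ _, by simp [weylPhase, symplecticForm]⟩

end Elementary

end ElementaryGates

section SiteBases

variable {N : ℕ}

lemma inner_toPair (S T : Matrix (Fin N) (Fin N) ℂ) :
    inner ℂ (toPair N S) (toPair N T) = (Sᴴ * T).trace := by
  simp only [toPair, PiLp.inner_apply, RCLike.inner_apply, Matrix.trace, Matrix.diag,
    Matrix.mul_apply, Matrix.conjTranspose_apply, Fintype.sum_prod_type]
  rw [Finset.sum_comm]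
  simp [mul_comm]

lemma toPair_mem_adjointSpace_iff [NeZero N] {T : Matrix (Fin N) (Fin N) ℂ} :
    toPair N T ∈ adjointSpace N ↔ T.trace = 0 := by
  have hsinglet : singlet N = toPair N (((1 / Real.sqrt N : ℝ) : ℂ) • 1) := by
    ext p
    simp [singlet, toPair, Matrix.one_apply]
  rw [adjointSpace, Submodule.mem_orthogonal_singleton_iff_inner_right, hsinglet, inner_toPair]
  simp [NeZero.ne N]

lemma finrank_adjointSpace [NeZero N] : Module.finrank ℂ (adjointSpace N) = N ^ 2 - 1 := by
  have hsinglet : singlet N ≠ 0 := fun h => by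
    simpa [singlet, NeZero.ne N] using congrArg (fun T : PairSpace N => T (0, 0)) h
  have hsum := Submodule.finrank_add_finrank_orthogonal (Submodule.span ℂ {singlet N})
  rw [finrank_span_singleton hsinglet, finrank_euclideanSpace, Fintype.card_prod, Fintype.card_fin]
    at hsum
  rw [adjointSpace, sq, ← hsum, Nat.add_sub_cancel_left]

lemma exists_siteBasis [NeZero N] {c t : ℝ} (hct : c * c * t = 1)
    (f : Label N → Matrix (Fin N) (Fin N) ℂ) (htrace : ∀ α, (f α).trace = 0)
    (horth : ∀ α β, ((f α)ᴴ * f β).trace = if α = β then (t : ℂ) else 0) :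
    ∃ B : SiteBasis N, ∀ α, (B α : PairSpace N) = toPair N ((c : ℂ) • f α) := by
  have hmem : ∀ α, toPair N ((c : ℂ) • f α) ∈ adjointSpace N := fun α => by
    rw [toPair_mem_adjointSpace_iff, Matrix.trace_smul, htrace, smul_zero]
  have hon : Orthonormal ℂ fun α => (⟨_, hmem α⟩ : adjointSpace N) := by
    rw [orthonormal_iff_ite]
    intro α β
    rw [Submodule.coe_inner, inner_toPair, Matrix.conjTranspose_smul, smul_mul_smul_comm,
      Matrix.trace_smul, horth, Complex.star_def, Complex.conj_ofReal, smul_ite, smul_zero,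
      smul_eq_mul, ← Complex.ofReal_mul, ← Complex.ofReal_mul, hct, Complex.ofReal_one]
  have hspan := hon.linearIndependent.span_eq_top_of_card_eq_finrank'
    (by rw [card_label, finrank_adjointSpace])
  exact ⟨OrthonormalBasis.mk hon hspan.ge, fun α => by rw [OrthonormalBasis.coe_mk]⟩

lemma kraus_toPair_smul (c : ℝ) (T : Matrix (Fin N) (Fin N) ℂ) :
    kraus N (toPair N ((c : ℂ) • T)) =
      ((Real.sqrt (N / ((N : ℝ) ^ 2 - 1)) * c : ℝ) : ℂ) • Tᴴ := by
  change _ • ((c : ℂ) • T)ᴴ = _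
  rw [Matrix.conjTranspose_smul, smul_smul, Complex.star_def, Complex.conj_ofReal,
    Complex.ofReal_mul]

lemma exists_unitary_kraus (B M : SiteBasis N) :
    ∃ U ∈ Matrix.unitaryGroup (Label N) ℂ, ∀ α,
      ∑ β, U α β • kraus N (M β) = kraus N (B α) := by
  refine ⟨B.toBasis.toMatrix M, B.toMatrix_orthonormalBasis_mem_unitary M, fun α => ?_⟩
  have hexpand : (B α : PairSpace N) = ∑ β, inner ℂ (M β) (B α) • (M β : PairSpace N) := by
    conv_lhs => rw [← M.sum_repr' (B α)]
    simp
  have hkraus : kraus N (B α) = ∑ β, star (inner ℂ (M β) (B α)) • kraus N (M β) := by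
    rw [hexpand]
    ext a b
    simp [kraus, toMat, Matrix.sum_apply, Finset.mul_sum, mul_left_comm]
  rw [hkraus]
  refine Finset.sum_congr rfl fun β _ => ?_
  rw [Module.Basis.toMatrix_apply, OrthonormalBasis.coe_toBasis_repr_apply,
    OrthonormalBasis.repr_apply_apply]
  exact congrArg (· • kraus N (M β)) (inner_conj_symm (B α) (M β)).symm

section Rotated

variable {V : Matrix (Fin N) (Fin N) ℂ}

lemma pairAction_toPair (V T : Matrix (Fin N) (Fin N) ℂ) :
    pairAction N V (toPair N T) = toPair N (V * T * Vᴴ) := by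
  ext p
  simp only [pairAction, toPair, Matrix.mul_apply, Matrix.conjTranspose_apply,
    Fintype.sum_prod_type, Finset.sum_mul]
  rw [Finset.sum_comm]
  exact Finset.sum_congr rfl fun _ _ => Finset.sum_congr rfl fun _ _ => by ring

lemma pairAction_hwVector (V : Matrix (Fin N) (Fin N) ℂ) (α : Label N) :
    pairAction N Vᴴ (hwVector N α) =
      toPair N (((1 / Real.sqrt N : ℝ) : ℂ) • (Vᴴ * hw N α.1 * V)ᴴ) := by
  simp only [hwVector, pairAction_toPair, Matrix.conjTranspose_mul,
    Matrix.conjTranspose_conjTranspose, mul_smul_comm, smul_mul_assoc, mul_assoc]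

lemma exists_isRotatedBy [NeZero N] (hV : V ∈ Matrix.unitaryGroup (Fin N) ℂ) :
    ∃ B : SiteBasis N, IsRotatedBy N V B := by
  have hVV : V * Vᴴ = 1 := Matrix.mem_unitaryGroup_iff.1 hV
  have hct : 1 / Real.sqrt N * (1 / Real.sqrt N) * N = 1 := by
    rw [div_mul_div_comm, one_mul, Real.mul_self_sqrt (Nat.cast_nonneg N)]
    exact one_div_mul_cancel (NeZero.ne _)
  simp only [IsRotatedBy, pairAction_hwVector]
  refine exists_siteBasis hct _ (fun α => ?_) fun α β => ?_
  · have hα : α.1 ≠ 0 := fun h => α.2 (by simp [h])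
    rw [Matrix.trace_conjTranspose, Matrix.trace_mul_cycle, hVV, one_mul, trace_hw, if_neg hα,
      star_zero]
  · have hprod : (Vᴴ * hw N α.1 * V) * (Vᴴ * hw N β.1 * V)ᴴ =
        Vᴴ * (hw N α.1 * (hw N β.1)ᴴ) * V := by
      simp only [Matrix.conjTranspose_mul, Matrix.conjTranspose_conjTranspose, mul_assoc]
      rw [← mul_assoc V Vᴴ, hVV, one_mul]
    rw [Matrix.conjTranspose_conjTranspose, hprod, Matrix.trace_mul_cycle, hVV, one_mul,
      Matrix.trace_mul_comm, trace_hw_conjTranspose_mul, Complex.ofReal_natCast]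
    simp only [← Subtype.ext_iff, eq_comm]

lemma IsRotatedBy.kraus [NeZero N] {B : SiteBasis N} (hB : IsRotatedBy N V B) (α : Label N) :
    kraus N (B α) = ((1 / Real.sqrt ((N : ℝ) ^ 2 - 1) : ℝ) : ℂ) • (Vᴴ * hw N α.1 * V) := by
  have hN : Real.sqrt N ≠ 0 := by simp [NeZero.ne N]
  rw [hB, pairAction_hwVector, kraus_toPair_smul, Matrix.conjTranspose_conjTranspose,
    Real.sqrt_div (Nat.cast_nonneg N), div_mul_div_comm, mul_one, mul_comm (Real.sqrt (_ - _)),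
    div_mul_cancel_left₀ hN, one_div]

end Rotated

section GellMann

/-- The entries `1, …, 1, -i, 0, …, 0` of the unnormalized `i`-th diagonal Gell-Mann matrix. -/
def gellMannDiag (i l : Fin N) : ℂ :=
  if l < i then 1 else if l = i then -(i.val : ℂ) else 0

/-- The coefficient of `|i⟩⟨j|` in the off-diagonal Gell-Mann matrix with label `(i, j)`. -/
def gellMannCoeff (i j : Fin N) : ℂ :=
  if i < j then 1 / 2 else Complex.I / 2

lemma gellMann_of_ne {i j : Fin N} (h : ¬ (i.val = 0 ∧ j.val = 0)) (hij : i ≠ j) :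
    gellMann N ⟨(i, j), h⟩ =
      gellMannCoeff i j • Matrix.single i j 1 + star (gellMannCoeff i j) • Matrix.single j i 1 := by
  rcases lt_or_gt_of_ne hij with hlt | hlt
  · simp [gellMann, gellMannCoeff, hlt, smul_add]
  · simp [gellMann, gellMannCoeff, hlt, hlt.not_gt, neg_div, smul_sub]
    abel

lemma gellMann_self {i : Fin N} (h : ¬ (i.val = 0 ∧ i.val = 0)) :
    gellMann N ⟨(i, i), h⟩ = ((1 / Real.sqrt (2 * (i.val + 1) * i.val) : ℝ) : ℂ) •
      Matrix.diagonal (gellMannDiag i) := by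
  simp only [gellMann, lt_irrefl, if_false]
  congr 1
  ext a b
  simp only [Matrix.sub_apply, Matrix.sum_apply, Matrix.smul_apply, Matrix.single_apply,
    Matrix.diagonal_apply, gellMannDiag]
  rcases eq_or_ne a b with rfl | hab
  · rcases lt_trichotomy a i with hi | rfl | hi
    · simp [hi, hi.ne']
    · simp
    · simp [hi.ne, hi.ne', hi.not_gt]
  · have hempty : ∀ l : Fin N, ¬ (l = a ∧ l = b) := fun l hl => hab (hl.1.symm.trans hl.2)
    simp [hab, hempty]

lemma sum_mul_gellMannDiag (f : Fin N → ℂ) (i : Fin N) :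
    ∑ l, f l * gellMannDiag i l = ∑ l ∈ Finset.Iio i, f l - i.val * f i := by
  have hsplit : ∀ l, f l * gellMannDiag i l =
      (if l < i then f l else 0) - if l = i then i.val * f l else 0 := fun l => by
    rcases lt_trichotomy l i with h | rfl | h
    · simp [gellMannDiag, h, h.ne]
    · simp [gellMannDiag, mul_comm]
    · simp [gellMannDiag, h.ne', h.not_gt]
  simp only [hsplit, Finset.sum_sub_distrib, ← Finset.sum_filter, Finset.filter_gt_eq_Iio,
    Finset.filter_eq', Finset.mem_univ, if_true, Finset.sum_singleton]

lemma sum_gellMannDiag (i : Fin N) : ∑ l, gellMannDiag i l = 0 := by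
  simpa using sum_mul_gellMannDiag 1 i

lemma sum_gellMannDiag_mul_of_lt {i j : Fin N} (hij : i < j) :
    ∑ l, gellMannDiag j l * gellMannDiag i l = 0 := by
  have hlt : ∀ l ∈ Finset.Iio i, gellMannDiag j l = 1 := fun l hl =>
    if_pos ((Finset.mem_Iio.1 hl).trans hij)
  rw [sum_mul_gellMannDiag, Finset.sum_congr rfl hlt, gellMannDiag, if_pos hij]
  simp

lemma sum_gellMannDiag_mul_self (i : Fin N) :
    ∑ l, gellMannDiag i l * gellMannDiag i l = (i.val + 1) * i.val := by
  have hlt : ∀ l ∈ Finset.Iio i, gellMannDiag i l = 1 := fun l hl =>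
    if_pos (Finset.mem_Iio.1 hl)
  rw [sum_mul_gellMannDiag, Finset.sum_congr rfl hlt]
  simp [gellMannDiag]
  ring

lemma gellMann_isHermitian (β : Label N) : (gellMann N β)ᴴ = gellMann N β := by
  obtain ⟨⟨i, j⟩, h⟩ := β
  rcases eq_or_ne i j with rfl | hij
  · rw [gellMann_self, Matrix.conjTranspose_smul, Matrix.diagonal_conjTranspose, Complex.star_def,
      Complex.conj_ofReal]
    congr 2
    ext l
    simp only [gellMannDiag, Pi.star_apply]
    split_ifs <;> simp
  · rw [gellMann_of_ne h hij]
    simp [Matrix.conjTranspose_single, add_comm]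

lemma trace_gellMann (β : Label N) : (gellMann N β).trace = 0 := by
  obtain ⟨⟨i, j⟩, h⟩ := β
  rcases eq_or_ne i j with rfl | hij
  · rw [gellMann_self, Matrix.trace_smul, Matrix.trace_diagonal, sum_gellMannDiag, smul_zero]
  · rw [gellMann_of_ne h hij]
    simp [Matrix.trace_single_eq_of_ne, hij, hij.symm]

lemma trace_mul_gellMann_of_ne (A : Matrix (Fin N) (Fin N) ℂ) {i j : Fin N}
    (h : ¬ (i.val = 0 ∧ j.val = 0)) (hij : i ≠ j) :
    (A * gellMann N ⟨(i, j), h⟩).trace =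
      gellMannCoeff i j * A j i + star (gellMannCoeff i j) * A i j := by
  rw [gellMann_of_ne h hij, Matrix.trace_mul_comm]
  simp [add_mul, Matrix.trace_single_mul]

lemma trace_gellMann_mul_of_ne {i j k l : Fin N} (h : ¬ (i.val = 0 ∧ j.val = 0)) (hij : i ≠ j)
    (h' : ¬ (k.val = 0 ∧ l.val = 0)) (hkl : k ≠ l) :
    (gellMann N ⟨(i, j), h⟩ * gellMann N ⟨(k, l), h'⟩).trace =
      if i = k ∧ j = l then 1 / 2 else 0 := by
  have hI : Complex.I / 2 * (Complex.I / 2) = -(1 / 4) := by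
    linear_combination Complex.I_mul_I / 4
  have hdirect : gellMannCoeff i j * star (gellMannCoeff i j) = 1 / 4 := by
    unfold gellMannCoeff
    split_ifs <;> norm_num [neg_div, hI]
  have hcross : gellMannCoeff i j * gellMannCoeff j i +
      star (gellMannCoeff i j) * star (gellMannCoeff j i) = 0 := by
    rcases lt_or_gt_of_ne hij with hlt | hlt <;>
      simp [gellMannCoeff, hlt, hlt.not_gt, neg_div]
  rw [trace_mul_gellMann_of_ne _ h' hkl, gellMann_of_ne h hij]
  simp only [Matrix.add_apply, Matrix.smul_apply, Matrix.single_apply, smul_eq_mul]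
  by_cases hdir : i = k ∧ j = l
  · obtain ⟨rfl, rfl⟩ := hdir
    simp [hij, hij.symm]
    linear_combination (norm := (simp; ring)) 2 * hdirect
  · by_cases hswap : i = l ∧ j = k
    · obtain ⟨rfl, rfl⟩ := hswap
      simp [hij, hij.symm]
      linear_combination (norm := (simp; ring)) hcross
    · simp [hdir, hswap, and_comm]

lemma trace_gellMann_self_mul {i k : Fin N} (h : ¬ (i.val = 0 ∧ i.val = 0))
    (h' : ¬ (k.val = 0 ∧ k.val = 0)) :
    (gellMann N ⟨(i, i), h⟩ * gellMann N ⟨(k, k), h'⟩).trace = if i = k then 1 / 2 else 0 := by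
  rw [gellMann_self h, gellMann_self h', smul_mul_smul_comm, Matrix.diagonal_mul_diagonal,
    Matrix.trace_smul, Matrix.trace_diagonal]
  rcases lt_trichotomy i k with hik | rfl | hik
  · simp only [mul_comm (gellMannDiag i _)]
    rw [sum_gellMannDiag_mul_of_lt hik, if_neg hik.ne, smul_zero]
  · have hi : (0 : ℝ) < i.val := by
      exact_mod_cast Nat.pos_of_ne_zero fun h0 => h ⟨h0, h0⟩
    have hnorm : 1 / (2 * (i.val + 1) * i.val : ℝ) * ((i.val + 1) * i.val) = 1 / 2 := by
      field_simp
    rw [sum_gellMannDiag_mul_self, if_pos rfl, ← Complex.ofReal_mul, div_mul_div_comm, one_mul,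
      Real.mul_self_sqrt (by positivity), smul_eq_mul]
    simpa using congrArg Complex.ofReal hnorm
  · rw [sum_gellMannDiag_mul_of_lt hik, if_neg hik.ne', smul_zero]

lemma trace_gellMann_mul (β γ : Label N) :
    (gellMann N β * gellMann N γ).trace = if β = γ then 1 / 2 else 0 := by
  obtain ⟨⟨i, j⟩, h⟩ := β
  obtain ⟨⟨k, l⟩, h'⟩ := γ
  simp only [Subtype.mk.injEq, Prod.mk.injEq]
  rcases eq_or_ne i j with rfl | hij <;> rcases eq_or_ne k l with rfl | hkl
  · simp only [trace_gellMann_self_mul, and_self]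
  · rw [trace_mul_gellMann_of_ne _ h' hkl, gellMann_self]
    simp [hkl, hkl.symm, show ¬ (i = k ∧ i = l) from fun e => hkl (e.1.symm.trans e.2)]
  · rw [Matrix.trace_mul_comm, trace_mul_gellMann_of_ne _ h hij, gellMann_self]
    simp [hij, hij.symm, show ¬ (i = k ∧ j = k) from fun e => hij (e.1.trans e.2.symm)]
  · exact trace_gellMann_mul_of_ne h hij h' hkl

lemma exists_gellMann_basis [NeZero N] :
    ∃ M : SiteBasis N, ∀ β,
      (M β : PairSpace N) = toPair N ((Real.sqrt 2 : ℂ) • gellMann N β) := by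
  refine exists_siteBasis (t := 1 / 2) ?_ _ trace_gellMann fun β γ => ?_
  · norm_num
  · rw [gellMann_isHermitian, trace_gellMann_mul]
    norm_num

lemma kraus_gellMann (β : Label N) :
    kraus N (toPair N ((Real.sqrt 2 : ℂ) • gellMann N β)) =
      ((Real.sqrt (2 * N / ((N : ℝ) ^ 2 - 1)) : ℝ) : ℂ) • gellMann N β := by
  rw [kraus_toPair_smul, gellMann_isHermitian, mul_comm, ← Real.sqrt_mul zero_le_two,
    mul_div_assoc]

end GellMann

end SiteBases

section Chain

lemma sum_norm_mulVec_of_sum_conjTranspose_mul {ι m n : Type*} [Fintype ι] [Fintype m] [Fintype n]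
    [DecidableEq n] {A : ι → Matrix m n ℂ} (hA : ∑ i, (A i)ᴴ * A i = 1) (φ : n → ℂ) :
    ∑ i, ∑ e, ‖(A i *ᵥ φ) e‖ ^ 2 = ∑ e, ‖φ e‖ ^ 2 := by
  have hsum : ∑ i, star (A i *ᵥ φ) ⬝ᵥ (A i *ᵥ φ) = star φ ⬝ᵥ φ := by
    simp only [Matrix.star_mulVec, ← Matrix.dotProduct_mulVec, Matrix.mulVec_mulVec]
    rw [← dotProduct_sum, ← Matrix.sum_mulVec, hA, Matrix.one_mulVec]
  simp only [star_dotProduct_self_eq_sum] at hsum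
  exact_mod_cast hsum

lemma sum_snoc {A M : Type*} [Fintype A] [AddCommMonoid M] {n : ℕ} (f : (Fin (n + 1) → A) → M) :
    ∑ t, f t = ∑ t : Fin n → A, ∑ a, f (Fin.snoc t a) := by
  rw [← (Fin.snocEquiv fun _ => A).sum_comp, Fintype.sum_prod_type, Finset.sum_comm]
  rfl

lemma ofFn_snoc {A : Type*} {n : ℕ} (o : Fin n → A) (a : A) :
    List.ofFn (Fin.snoc o a : Fin (n + 1) → A) = List.ofFn o ++ [a] := by
  rw [List.ofFn_succ', List.concat_eq_append]
  simp only [Fin.snoc_castSucc, Fin.snoc_last]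

lemma take_ofFn_snoc {A : Type*} {n k : ℕ} (hk : k ≤ n) (o : Fin n → A) (a : A) :
    (List.ofFn (Fin.snoc o a : Fin (n + 1) → A)).take k = (List.ofFn o).take k := by
  rw [ofFn_snoc, List.take_append_of_le_length (by simpa using hk)]

variable {N : ℕ}

lemma star_singlet_dotProduct_singlet [NeZero N] : star (singlet N).ofLp ⬝ᵥ singlet N = 1 := by
  rw [star_dotProduct_self_eq_sum]
  simp [singlet, Fintype.sum_prod_type, apply_ite, -Complex.ofReal_inv, NeZero.ne N]

lemma adjointProj_eq_complexReflection [NeZero N] :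
    Matrix.of (adjointProj N) = complexReflection (singlet N).ofLp 0 := by
  ext s t
  simp [adjointProj, complexReflection, star_singlet_dotProduct_singlet, Matrix.one_apply,
    Matrix.vecMulVec_apply, sub_eq_add_neg]

lemma adjointProj_mulVec_of_mem [NeZero N] {T : PairSpace N} (hT : T ∈ adjointSpace N) :
    Matrix.of (adjointProj N) *ᵥ T = T := by
  rw [adjointSpace, Submodule.mem_orthogonal_singleton_iff_inner_right,
    EuclideanSpace.inner_eq_star_dotProduct, dotProduct_comm] at hT
  rw [adjointProj_eq_complexReflection, complexReflection_mulVec_of_orthogonal hT]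

lemma star_adjointProj [NeZero N] (s t : Fin N × Fin N) :
    star (adjointProj N s t) = adjointProj N t s := by
  have h : (Matrix.of (adjointProj N))ᴴ = Matrix.of (adjointProj N) := by
    rw [adjointProj_eq_complexReflection, complexReflection_conjTranspose, star_zero]
  exact congrFun₂ h t s

lemma sum_star_adjointProj_mul [NeZero N] (s t : Fin N × Fin N) :
    ∑ q, star (adjointProj N q s) * adjointProj N q t = adjointProj N s t := by
  have h : Matrix.of (adjointProj N) * Matrix.of (adjointProj N) = Matrix.of (adjointProj N) := by
    rw [adjointProj_eq_complexReflection, complexReflection_mul, mul_zero]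
  simpa only [Matrix.mul_apply, Matrix.of_apply, star_adjointProj] using congrFun₂ h s t

lemma sum_adjointProj_diag (l l' : Fin N) :
    ∑ e, adjointProj N (l, e) (l', e) = if l = l' then (N - 1 / N : ℂ) else 0 := by
  have hsqrt : ((Real.sqrt N : ℝ) : ℂ) * ((Real.sqrt N : ℝ) : ℂ) = N := by
    exact_mod_cast Real.mul_self_sqrt (Nat.cast_nonneg N)
  rcases eq_or_ne l l' with rfl | hl
  · simp [adjointProj, singlet, Finset.sum_sub_distrib, ← mul_inv, hsqrt]
  · simp [adjointProj, singlet, hl, hl.symm]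

/-- The tensor of the matrix product state: the operator on the virtual space that belongs to the
component `q` of the on-site state. -/
def siteOp (N : ℕ) (q : Fin N × Fin N) : Matrix (Fin N) (Fin N) ℂ :=
  ((Real.sqrt (N / ((N : ℝ) ^ 2 - 1)) : ℝ) : ℂ) • Matrix.of fun e l => adjointProj N q (l, e)

lemma sum_star_smul_siteOp [NeZero N] {T : PairSpace N} (hT : T ∈ adjointSpace N) :
    ∑ q, star (T q) • siteOp N q = kraus N T := by
  ext e l
  have hproj : ∑ q, star (T q) * adjointProj N q (l, e) = star (T (l, e)) := by
    conv_rhs => rw [← adjointProj_mulVec_of_mem hT]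
    simp only [Matrix.mulVec, dotProduct, Matrix.of_apply, star_sum, star_mul, star_adjointProj]
  simp only [siteOp, kraus, toMat, Matrix.sum_apply, Matrix.smul_apply, Matrix.of_apply,
    Matrix.conjTranspose_apply, smul_eq_mul, mul_left_comm, ← Finset.mul_sum, hproj]

lemma natCast_sq_sub_one_pos [N.AtLeastTwo] : 0 < (N : ℝ) ^ 2 - 1 := by
  have hN : (2 : ℝ) ≤ N := Nat.ofNat_le_cast.2 Nat.AtLeastTwo.prop
  nlinarith

lemma sum_siteOp_conjTranspose_mul [N.AtLeastTwo] : ∑ q, (siteOp N q)ᴴ * siteOp N q = 1 := by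
  have hpos := natCast_sq_sub_one_pos (N := N)
  have hN : (N : ℝ) ≠ 0 := Nat.cast_ne_zero.2 (NeZero.ne N)
  have hconst : star ((Real.sqrt (N / ((N : ℝ) ^ 2 - 1)) : ℝ) : ℂ) *
      ((Real.sqrt (N / ((N : ℝ) ^ 2 - 1)) : ℝ) : ℂ) * (N - 1 / N) = 1 := by
    have hreal : N / ((N : ℝ) ^ 2 - 1) * (N - 1 / N) = 1 := by field_simp
    rw [Complex.star_def, Complex.conj_ofReal, ← Complex.ofReal_mul,
      Real.mul_self_sqrt (by positivity)]
    simpa using congrArg Complex.ofReal hreal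
  ext l l'
  simp only [siteOp, Matrix.sum_apply, Matrix.conjTranspose_smul, smul_mul_smul_comm,
    Matrix.smul_apply, Matrix.mul_apply, Matrix.conjTranspose_apply, Matrix.of_apply,
    ← Finset.smul_sum]
  rw [Finset.sum_comm]
  simp only [sum_star_adjointProj_mul, sum_adjointProj_diag, smul_eq_mul, mul_ite, hconst,
    mul_zero, Matrix.one_apply]

lemma bondState_snoc {n : ℕ} (ψ : Fin N → ℂ) (t : Fin n → Fin N × Fin N) (p : Fin N × Fin N)
    (e : Fin N) :
    bondState N (n + 1) ψ (Fin.snoc t p) e = bondState N n ψ t p.1 * singlet N (e, p.2) := by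
  have hleft : (fun k => ((Fin.snoc t p : Fin (n + 1) → Fin N × Fin N) k).1) =
      (Fin.snoc (fun k => (t k).1) p.1 : Fin (n + 1) → Fin N) :=
    Fin.comp_snoc Prod.fst t p
  simp only [bondState, hleft]
  rw [Fin.prod_univ_castSucc, ← Fin.castSucc_zero, Fin.snoc_castSucc, Fin.succ_last,
    Fin.snoc_last, Fin.snoc_last, mul_assoc]
  simp only [← Fin.castSucc_succ, Fin.snoc_castSucc]

lemma akltState_snoc {n : ℕ} (ψ : Fin N → ℂ) (s : Fin n → Fin N × Fin N) (q : Fin N × Fin N) :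
    akltState N (n + 1) ψ (Fin.snoc s q) = siteOp N q *ᵥ akltState N n ψ s := by
  have hconst : N / Real.sqrt ((N : ℝ) ^ 2 - 1) * (1 / Real.sqrt N) =
      Real.sqrt (N / ((N : ℝ) ^ 2 - 1)) := by
    rw [Real.sqrt_div (Nat.cast_nonneg N), div_mul_div_comm, mul_one, mul_comm (Real.sqrt _),
      ← div_div, Real.div_sqrt]
  ext e
  simp only [akltState, Matrix.mulVec, dotProduct, siteOp, Matrix.smul_apply, Matrix.of_apply,
    sum_snoc, Fin.prod_univ_castSucc, Fin.snoc_castSucc, Fin.snoc_last, bondState_snoc,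
    pow_succ _ n, Finset.mul_sum, Fintype.sum_prod_type, singlet, mul_ite, mul_zero,
    Finset.sum_ite_eq, Finset.mem_univ, if_true]
  rw [Finset.sum_comm]
  refine Finset.sum_congr rfl fun l _ => Finset.sum_congr rfl fun t _ => ?_
  rw [← hconst]
  push_cast
  ring

lemma sum_norm_akltState [N.AtLeastTwo] (n : ℕ) (ψ : Fin N → ℂ) :
    ∑ s, ∑ e, ‖akltState N n ψ s e‖ ^ 2 = ∑ e, ‖ψ e‖ ^ 2 := by
  induction n with
  | zero => simp [akltState, bondState, Fin.snoc]
  | succ n ih =>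
    simp only [sum_snoc, akltState_snoc,
      sum_norm_mulVec_of_sum_conjTranspose_mul sum_siteOp_conjTranspose_mul, ih]

lemma postState_snoc [NeZero N] {n : ℕ} (B : List (Label N) → SiteBasis N) (ψ : Fin N → ℂ)
    (o : Fin n → Label N) (α : Label N) :
    postState N (n + 1) B ψ (Fin.snoc o α) =
      kraus N (B (List.ofFn o) α) *ᵥ postState N n B ψ o := by
  have htake : (List.ofFn o).take n = List.ofFn o := List.take_of_length_le (by simp)
  have hprev : ∀ k : Fin n, (List.ofFn (Fin.snoc o α : Fin (n + 1) → Label N)).take k.val =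
      (List.ofFn o).take k.val := fun k => take_ofFn_snoc k.isLt.le o α
  rw [← sum_star_smul_siteOp (B (List.ofFn o) α).2, Matrix.sum_mulVec]
  ext e
  simp only [postState, sum_snoc, Fin.prod_univ_castSucc, Fin.snoc_castSucc, Fin.snoc_last,
    Fin.val_castSucc, Fin.val_last, hprev, take_ofFn_snoc le_rfl, htake, akltState_snoc,
    Finset.sum_apply]
  rw [Finset.sum_comm]
  refine Finset.sum_congr rfl fun q _ => ?_
  simp only [Matrix.mulVec, dotProduct, Matrix.smul_apply, smul_eq_mul, Finset.mul_sum]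
  rw [Finset.sum_comm]
  refine Finset.sum_congr rfl fun l _ => ?_
  rw [postState, Finset.mul_sum]
  exact Finset.sum_congr rfl fun s _ => by ring

lemma virtualOp_snoc {n : ℕ} (B : List (Label N) → SiteBasis N) (o : Fin n → Label N)
    (α : Label N) :
    virtualOp N (n + 1) B (Fin.snoc o α) = kraus N (B (List.ofFn o) α) * virtualOp N n B o := by
  have htake : (List.ofFn o).take n = List.ofFn o := List.take_of_length_le (by simp)
  have hprev : ∀ k : Fin n, (List.ofFn (Fin.snoc o α : Fin (n + 1) → Label N)).take k.val =
      (List.ofFn o).take k.val := fun k => take_ofFn_snoc k.isLt.le o α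
  rw [virtualOp, List.ofFn_succ', List.concat_eq_append, List.reverse_append]
  simp only [Fin.snoc_castSucc, Fin.snoc_last, Fin.val_castSucc, Fin.val_last, hprev,
    take_ofFn_snoc le_rfl, htake, List.reverse_singleton, List.singleton_append, List.prod_cons]
  rfl

lemma postState_eq_virtualOp_mulVec [NeZero N] {n : ℕ} (B : List (Label N) → SiteBasis N)
    (ψ : Fin N → ℂ) (o : Fin n → Label N) :
    postState N n B ψ o = virtualOp N n B o *ᵥ ψ := by
  induction n with
  | zero =>
    ext e
    simp [postState, virtualOp, akltState, bondState, Fin.snoc]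
  | succ n ih =>
    rw [← Fin.snoc_init_self o, postState_snoc, virtualOp_snoc, ih, Matrix.mulVec_mulVec]

end Chain

section Protocols

variable {N : ℕ}

lemma GateProtocol.kraus_basis [NeZero N] (P : GateProtocol N) (h : List (Label N)) (α : Label N) :
    kraus N (P.basis h α) = ((1 / Real.sqrt ((N : ℝ) ^ 2 - 1) : ℝ) : ℂ) •
      (hw N α.1 * inducedGate N (P.gate h) α) := by
  rw [(P.rotated h).kraus, hw_mul_inducedGate]

section Probability

variable [N.AtLeastTwo]

lemma GateProtocol.prob_snoc (P : GateProtocol N) {n : ℕ} (ψ : Fin N → ℂ) (o : Fin n → Label N)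
    (α : Label N) :
    prob N (n + 1) P.basis ψ (Fin.snoc o α) = 1 / ((N : ℝ) ^ 2 - 1) * prob N n P.basis ψ o := by
  have hgate : hw N α.1 * inducedGate N (P.gate (List.ofFn o)) α ∈ Matrix.unitaryGroup (Fin N) ℂ :=
    mul_mem (hw_mem_unitaryGroup _) (Matrix.specialUnitaryGroup_le_unitaryGroup
      (inducedGate_mem_specialUnitaryGroup (P.elementary _).mem_unitaryGroup α))
  have hnorm := sum_norm_mulVec_of_sum_conjTranspose_mul
    (A := fun _ : Unit => hw N α.1 * inducedGate N (P.gate (List.ofFn o)) α)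
    (by rw [Fintype.sum_unique]; exact Matrix.mem_unitaryGroup_iff'.1 hgate)
    (postState N n P.basis ψ o)
  rw [Fintype.sum_unique] at hnorm
  rw [prob, prob, postState_snoc, P.kraus_basis, Matrix.smul_mulVec, ← hnorm, Finset.mul_sum]
  refine Finset.sum_congr rfl fun e _ => ?_
  rw [Pi.smul_apply, norm_smul, mul_pow, Complex.norm_real, Real.norm_eq_abs, sq_abs, div_pow,
    one_pow, Real.sq_sqrt natCast_sq_sub_one_pos.le]

lemma GateProtocol.prob_eq (P : GateProtocol N) {n : ℕ} {ψ : Fin N → ℂ} (hψ : ∑ e, ‖ψ e‖ ^ 2 = 1)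
    (o : Fin n → Label N) :
    prob N n P.basis ψ o = (1 / ((N : ℝ) ^ 2 - 1)) ^ n := by
  induction n with
  | zero => simpa [prob, postState_eq_virtualOp_mulVec, virtualOp] using hψ
  | succ n ih => rw [← Fin.snoc_init_self o, P.prob_snoc, ih, ← pow_succ']

open Classical in
lemma GateProtocol.sum_prob_inducedGate_ne_one (P : GateProtocol N) {n : ℕ} (ψ : Fin N → ℂ)
    {o : Fin n → Label N} (hgate : P.gate (List.ofFn o) ≠ 1) :
    ∑ α with inducedGate N (P.gate (List.ofFn o)) α ≠ 1,
        prob N (n + 1) P.basis ψ (Fin.snoc o α) =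
      (N / (N + 1) : ℝ) * prob N n P.basis ψ o := by
  have hcard : (Finset.card {α : Label N | inducedGate N (P.gate (List.ofFn o)) α ≠ 1} : ℝ) =
      (N : ℝ) ^ 2 - N := by
    have h := Finset.card_filter_add_card_filter_not (s := (Finset.univ : Finset (Label N)))
      (fun α => inducedGate N (P.gate (List.ofFn o)) α = 1)
    rw [(P.elementary _).card_inducedGate_eq_one hgate, Finset.card_univ] at h
    have hreal := congrArg (Nat.cast : ℕ → ℝ) h
    rw [Nat.cast_add, Nat.cast_sub NeZero.one_le, cast_card_label, Nat.cast_one] at hreal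
    linarith
  have hfactor : (N : ℝ) ^ 2 - 1 = (N - 1) * (N + 1) := by ring
  have hsub : (N : ℝ) - 1 ≠ 0 := fun h0 =>
    (natCast_sq_sub_one_pos (N := N)).ne' (by rw [hfactor, h0, zero_mul])
  simp only [P.prob_snoc]
  rw [Finset.sum_const, nsmul_eq_mul, hcard, ← mul_assoc, hfactor]
  congr 1
  field_simp

end Probability

/-- The product of the gates induced by a list of outcomes, when the gate measured after the earlier
outcomes `h` is `s h` and byproducts are left aside. -/
def gateProduct (s : List (Label N) → Matrix (Fin N) (Fin N) ℂ) :
    List (Label N) → Matrix (Fin N) (Fin N) ℂ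
  | [] => 1
  | α :: h => gateProduct (fun h' => s (α :: h')) h * inducedGate N (s []) α

lemma gateProduct_append_singleton (s : List (Label N) → Matrix (Fin N) (Fin N) ℂ)
    (h : List (Label N)) (α : Label N) :
    gateProduct s (h ++ [α]) = inducedGate N (s h) α * gateProduct s h := by
  induction h generalizing s with
  | nil => simp [gateProduct]
  | cons β h ih => rw [List.cons_append, gateProduct, ih, gateProduct, mul_assoc]

section Byproduct

variable [NeZero N]

lemma gateProduct_mem_specialUnitaryGroup {s : List (Label N) → Matrix (Fin N) (Fin N) ℂ}
    (hs : ∀ h, s h ∈ Matrix.unitaryGroup (Fin N) ℂ) (h : List (Label N)) :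
    gateProduct s h ∈ Matrix.specialUnitaryGroup (Fin N) ℂ := by
  induction h generalizing s with
  | nil => exact one_mem _
  | cons α h ih =>
    exact mul_mem (ih fun h' => hs (α :: h')) (inducedGate_mem_specialUnitaryGroup (hs []) α)

/-- The sum of the exponents of the outcomes: up to a phase, the product of their Heisenberg–Weyl
operators is the one of this pair. -/
def byproduct (h : List (Label N)) : Fin N × Fin N := (h.map Subtype.val).sum

lemma byproduct_append_singleton (h : List (Label N)) (α : Label N) :
    byproduct (h ++ [α]) = α.1 + byproduct h := by
  simp [byproduct, add_comm]

lemma inducedGate_mul_hw (V : Matrix (Fin N) (Fin N) ℂ) (b : Fin N × Fin N) (α : Label N) :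
    inducedGate N V α * hw N b = hw N b * inducedGate N ((hw N b)ᴴ * V * hw N b) α := by
  have hphase : star (weylPhase b α.1) * weylPhase b α.1 = 1 := by
    rw [weylPhase, star_rootCharacter, ← AddChar.map_add_eq_mul, neg_add_cancel,
      AddChar.map_zero_eq_one]
  have hconj : hw N b * hw N α.1 * (hw N b)ᴴ = weylPhase b α.1 • hw N α.1 := by
    rw [hw_mul_comm, smul_mul_assoc, mul_assoc, hw_mul_conjTranspose_self, mul_one]
  have hconj' : hw N b * (hw N α.1)ᴴ * (hw N b)ᴴ = star (weylPhase b α.1) • (hw N α.1)ᴴ := by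
    simpa [mul_assoc] using congrArg Matrix.conjTranspose hconj
  calc
    inducedGate N V α * hw N b =
        (star (weylPhase b α.1) • (hw N α.1)ᴴ) * Vᴴ * (weylPhase b α.1 • hw N α.1) * V *
          hw N b := by
      rw [smul_mul_assoc, smul_mul_smul_comm, hphase, one_smul, inducedGate]
    _ = hw N b * inducedGate N ((hw N b)ᴴ * V * hw N b) α := by
      rw [← hconj, ← hconj', inducedGate]
      simp only [Matrix.conjTranspose_mul, Matrix.conjTranspose_conjTranspose, mul_assoc]

/-- The gate that a scheme effectively measures after the outcomes `h`, once their byproduct is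
pulled out to the left. -/
def GateProtocol.correctedGate (P : GateProtocol N) (h : List (Label N)) :
    Matrix (Fin N) (Fin N) ℂ :=
  (hw N (byproduct h))ᴴ * P.gate h * hw N (byproduct h)

lemma GateProtocol.hw_mul_inducedGate_mul (P : GateProtocol N) (h : List (Label N)) (α : Label N) :
    ∃ c : ℂ, c ≠ 0 ∧
      hw N α.1 * inducedGate N (P.gate h) α *
          (hw N (byproduct h) * gateProduct P.correctedGate h) =
        c • (hw N (byproduct (h ++ [α])) * gateProduct P.correctedGate (h ++ [α])) := by
  have hpull : inducedGate N (P.gate h) α * hw N (byproduct h) =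
      hw N (byproduct h) * inducedGate N (P.correctedGate h) α := inducedGate_mul_hw _ _ _
  refine ⟨rootCharacter N (-(α.1.2 * (byproduct h).1)), rootCharacter_ne_zero _, ?_⟩
  rw [gateProduct_append_singleton, byproduct_append_singleton, ← smul_mul_assoc, ← hw_mul,
    mul_assoc, ← mul_assoc (inducedGate _ _ _), hpull]
  simp only [mul_assoc]

end Byproduct

variable [N.AtLeastTwo]

lemma GateProtocol.exists_virtualOp_eq (P : GateProtocol N) {n : ℕ} (o : Fin n → Label N) :
    ∃ c : ℂ, c ≠ 0 ∧ virtualOp N n P.basis o =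
      c • (hw N (byproduct (List.ofFn o)) * gateProduct P.correctedGate (List.ofFn o)) := by
  induction n with
  | zero => exact ⟨1, one_ne_zero, by simp [virtualOp, byproduct, gateProduct, hw_zero]⟩
  | succ n ih =>
    obtain ⟨c, hc, hop⟩ := ih (Fin.init o)
    obtain ⟨d, hd, hstep⟩ := P.hw_mul_inducedGate_mul (List.ofFn (Fin.init o)) (o (Fin.last n))
    have hscale : ((1 / Real.sqrt ((N : ℝ) ^ 2 - 1) : ℝ) : ℂ) ≠ 0 :=
      Complex.ofReal_ne_zero.2 (one_div_ne_zero (Real.sqrt_pos.2 natCast_sq_sub_one_pos).ne')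
    refine ⟨_, mul_ne_zero (mul_ne_zero hscale hc) hd, ?_⟩
    rw [← Fin.snoc_init_self o, virtualOp_snoc, P.kraus_basis, hop, smul_mul_smul_comm,
      ofFn_snoc, mul_smul _ d, ← hstep]

lemma GateProtocol.exists_postState_eq (P : GateProtocol N) {n : ℕ} (o : Fin n → Label N) :
    ∃ G ∈ Matrix.specialUnitaryGroup (Fin N) ℂ, ∃ (b : Fin N × Fin N) (c : ℂ), c ≠ 0 ∧
      ∀ ψ, postState N n P.basis ψ o = c • ((hw N b * G) *ᵥ ψ) := by
  obtain ⟨c, hc, hop⟩ := P.exists_virtualOp_eq o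
  have hcorrected : ∀ h, P.correctedGate h ∈ Matrix.unitaryGroup (Fin N) ℂ := fun h =>
    mul_mem (mul_mem (Unitary.star_mem (hw_mem_unitaryGroup _)) (P.elementary h).mem_unitaryGroup)
      (hw_mem_unitaryGroup _)
  refine ⟨_, gateProduct_mem_specialUnitaryGroup hcorrected (List.ofFn o),
    byproduct (List.ofFn o), c, hc, fun ψ => ?_⟩
  rw [postState_eq_virtualOp_mulVec, hop, Matrix.smul_mulVec]

/-- The scheme that measures the gates `s h`, corrected for the byproducts of the earlier
outcomes. -/
def correctedProtocol (s : List (Label N) → Matrix (Fin N) (Fin N) ℂ)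
    (hs : ∀ h, IsElementaryGate N (s h)) : GateProtocol N where
  gate h := hw N (byproduct h) * s h * (hw N (byproduct h))ᴴ
  basis h := (exists_isRotatedBy ((hs h).hw_mul_mul_conjTranspose _).mem_unitaryGroup).choose
  elementary h := (hs h).hw_mul_mul_conjTranspose _
  rotated h := (exists_isRotatedBy ((hs h).hw_mul_mul_conjTranspose _).mem_unitaryGroup).choose_spec

lemma correctedGate_correctedProtocol {s : List (Label N) → Matrix (Fin N) (Fin N) ℂ}
    (hs : ∀ h, IsElementaryGate N (s h)) :
    (correctedProtocol s hs).correctedGate = s := by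
  funext h
  simp only [GateProtocol.correctedGate, correctedProtocol, mul_assoc, hw_conjTranspose_mul_self,
    mul_one]
  rw [← mul_assoc, hw_conjTranspose_mul_self, one_mul]

end Protocols

section Performs

open BigOperators

variable {N : ℕ}

/-- The outcomes `h` perform the target `T`, up to a scalar and the byproduct, when the gates `s`
are measured. -/
def Achieves (s : List (Label N) → Matrix (Fin N) (Fin N) ℂ) (T : Matrix (Fin N) (Fin N) ℂ)
    (h : List (Label N)) : Prop :=
  ∃ c : ℂ, c ≠ 0 ∧ gateProduct s h = c • T

open Classical in
/-- The proportion of the outcomes on `n` sites that do not perform the target `T`, which is the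
failure probability since the outcomes are uniformly distributed. -/
def failureRate (n : ℕ) (s : List (Label N) → Matrix (Fin N) (Fin N) ℂ)
    (T : Matrix (Fin N) (Fin N) ℂ) : ℝ :=
  𝔼 o : Fin n → Label N, if Achieves s T (List.ofFn o) then 0 else 1

lemma achieves_cons [NeZero N] {s : List (Label N) → Matrix (Fin N) (Fin N) ℂ}
    (hs : s [] ∈ Matrix.unitaryGroup (Fin N) ℂ) (T : Matrix (Fin N) (Fin N) ℂ) (α : Label N)
    (h : List (Label N)) :
    Achieves s T (α :: h) ↔
      Achieves (fun h' => s (α :: h')) (T * (inducedGate N (s []) α)ᴴ) h := by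
  have hG := Matrix.specialUnitaryGroup_le_unitaryGroup (inducedGate_mem_specialUnitaryGroup hs α)
  have hl : (inducedGate N (s []) α)ᴴ * inducedGate N (s []) α = 1 :=
    Matrix.mem_unitaryGroup_iff'.1 hG
  have hr : inducedGate N (s []) α * (inducedGate N (s []) α)ᴴ = 1 :=
    Matrix.mem_unitaryGroup_iff.1 hG
  refine exists_congr fun c => and_congr_right fun _ => ⟨fun hc => ?_, fun hc => ?_⟩
  · rw [← smul_mul_assoc, ← hc, gateProduct, mul_assoc, hr, mul_one]
  · rw [gateProduct, hc, smul_mul_assoc, mul_assoc, hl, mul_one]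

open Classical in
lemma failureRate_succ [NeZero N] {s : List (Label N) → Matrix (Fin N) (Fin N) ℂ}
    (hs : s [] ∈ Matrix.unitaryGroup (Fin N) ℂ) (n : ℕ) (T : Matrix (Fin N) (Fin N) ℂ) :
    failureRate (n + 1) s T =
      𝔼 α, failureRate n (fun h => s (α :: h)) (T * (inducedGate N (s []) α)ᴴ) := by
  unfold failureRate
  rw [← Finset.expect_product', Finset.univ_product_univ]
  refine (Fintype.expect_equiv (Fin.consEquiv fun _ => Label N) _ _ fun p => ?_).symm
  have hcons : List.ofFn (Fin.consEquiv (fun _ => Label N) p) = p.1 :: List.ofFn p.2 :=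
    List.ofFn_cons _ _
  rw [hcons]
  exact if_congr (achieves_cons hs T _ _).symm rfl rfl

lemma failureRate_le_one (n : ℕ) (s : List (Label N) → Matrix (Fin N) (Fin N) ℂ)
    (T : Matrix (Fin N) (Fin N) ℂ) : failureRate n s T ≤ 1 := by
  classical
  rw [failureRate, Finset.expect_eq_sum_div_card]
  refine div_le_one_of_le₀ ?_ (Nat.cast_nonneg _)
  refine (Finset.sum_le_card_nsmul _ _ 1 fun o _ => ?_).trans_eq (by simp)
  split_ifs <;> norm_num

lemma achieves_one [NeZero N] {c : ℂ} (hc : c ≠ 0) (h : List (Label N)) :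
    Achieves (fun _ => 1) (c • 1 : Matrix (Fin N) (Fin N) ℂ) h := by
  have hone : gateProduct (fun _ => (1 : Matrix (Fin N) (Fin N) ℂ)) h = 1 := by
    induction h with
    | nil => rfl
    | cons α h ih =>
      rw [gateProduct, ih, inducedGate, Matrix.conjTranspose_one, one_mul, mul_one, mul_one,
        hw_conjTranspose_mul_self]
  exact ⟨c⁻¹, inv_ne_zero hc, by rw [hone, inv_smul_smul₀ hc]⟩

/-- `Performs n T q`: the target `T` can be performed, up to a scalar, on `n` sites with failure
probability at most `q`. In `measure`, the target that remains after the outcome `α` has to be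
performed with failure probability at most `r α`. -/
inductive Performs : ℕ → Matrix (Fin N) (Fin N) ℂ → ℝ → Prop
  | done {n : ℕ} {c : ℂ} {q : ℝ} (hc : c ≠ 0) (hq : 0 ≤ q) : Performs n (c • 1) q
  | giveUp {n : ℕ} {T : Matrix (Fin N) (Fin N) ℂ} {q : ℝ} (hq : 1 ≤ q) : Performs n T q
  | measure {n : ℕ} {T : Matrix (Fin N) (Fin N) ℂ} {q : ℝ} {V : Matrix (Fin N) (Fin N) ℂ}
      (hV : IsElementaryGate N V) (r : Label N → ℝ)
      (h : ∀ α, Performs n (T * (inducedGate N V α)ᴴ) (r α)) (hq : 𝔼 α, r α ≤ q) :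
      Performs (n + 1) T q

namespace Performs

variable {n m : ℕ} {T T' : Matrix (Fin N) (Fin N) ℂ} {q q' : ℝ}

lemma nonneg (h : Performs n T q) : 0 ≤ q := by
  induction h with
  | done _ hq => exact hq
  | giveUp hq => exact zero_le_one.trans hq
  | measure _ r _ hq ih => exact (Finset.expect_nonneg fun α _ => ih α).trans hq

lemma mono (h : Performs n T q) (hnm : n ≤ m) (hq : q ≤ q') : Performs m T q' := by
  induction h generalizing m q' with
  | done hc h0 => exact .done hc (h0.trans hq)
  | giveUp h1 => exact .giveUp (h1.trans hq)
  | measure hV r _ hr ih =>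
    obtain ⟨m, rfl⟩ := Nat.exists_eq_add_one_of_ne_zero (Nat.ne_zero_of_lt hnm)
    exact .measure hV r (fun α => ih α (Nat.le_of_succ_le_succ hnm) le_rfl) (hr.trans hq)

lemma smul (h : Performs n T q) {c : ℂ} (hc : c ≠ 0) : Performs n (c • T) q := by
  induction h with
  | done hd hq => rw [smul_smul]; exact .done (mul_ne_zero hc hd) hq
  | giveUp hq => exact .giveUp hq
  | measure hV r _ hq ih => exact .measure hV r (fun α => by rw [smul_mul_assoc]; exact ih α) hq

variable [N.AtLeastTwo]

lemma mul (h : Performs n T q) (h' : Performs m T' q') : Performs (n + m) (T' * T) (q + q') := by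
  induction h with
  | done hc hq =>
    rw [mul_smul_comm, mul_one]
    exact (h'.smul hc).mono (Nat.le_add_left _ _) (le_add_of_nonneg_left hq)
  | giveUp hq => exact .giveUp (le_add_of_le_of_nonneg hq h'.nonneg)
  | measure hV r _ hq ih =>
    rw [Nat.succ_add]
    refine .measure hV (fun α => r α + q') (fun α => by rw [mul_assoc]; exact ih α) ?_
    rw [Finset.expect_add_distrib, Fintype.expect_const]
    exact add_le_add_left hq q'

lemma exists_failureRate_le (h : Performs n T q) :
    ∃ s : List (Label N) → Matrix (Fin N) (Fin N) ℂ, (∀ h, IsElementaryGate N (s h)) ∧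
      failureRate n s T ≤ q := by
  induction h with
  | done hc hq =>
    refine ⟨fun _ => 1, fun _ => isElementaryGate_one, ?_⟩
    rw [failureRate, Finset.expect_eq_zero fun o _ => if_pos (achieves_one hc _)]
    exact hq
  | giveUp hq =>
    exact ⟨fun _ => 1, fun _ => isElementaryGate_one, (failureRate_le_one _ _ _).trans hq⟩
  | measure hV _ _ hq ih =>
    choose s hs hrate using ih
    refine ⟨fun | [] => _ | α :: h => s α h, fun | [] => hV | α :: h => hs α h, ?_⟩
    refine (failureRate_succ (hV.mem_unitaryGroup :) _ _).trans_le ?_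
    exact (Finset.expect_le_expect fun α _ => hrate α).trans hq

end Performs

/-- The targets that can be performed, up to a scalar, with arbitrarily small failure
probability. -/
def performable (N : ℕ) [N.AtLeastTwo] : Submonoid (Matrix (Fin N) (Fin N) ℂ) where
  carrier := {T | ∀ ε : ℝ, 0 < ε → ∃ n, Performs n T ε}
  one_mem' := fun ε hε => ⟨0, by simpa using Performs.done (n := 0) (N := N) one_ne_zero hε.le⟩
  mul_mem' := by
    intro T' T hT' hT ε hε
    obtain ⟨n, hn⟩ := hT (ε / 2) (half_pos hε)
    obtain ⟨m, hm⟩ := hT' (ε / 2) (half_pos hε)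
    exact ⟨n + m, add_halves ε ▸ hn.mul hm⟩

lemma smul_mem_performable [N.AtLeastTwo] {T : Matrix (Fin N) (Fin N) ℂ} (hT : T ∈ performable N)
    {c : ℂ} (hc : c ≠ 0) : c • T ∈ performable N := fun ε hε =>
  (hT ε hε).imp fun _ hn => hn.smul hc

open Classical in
lemma sum_prob_correctedProtocol [N.AtLeastTwo]
    {s : List (Label N) → Matrix (Fin N) (Fin N) ℂ} (hs : ∀ h, IsElementaryGate N (s h)) (n : ℕ)
    (T : Matrix (Fin N) (Fin N) ℂ) {ψ : Fin N → ℂ} (hψ : ∑ e, ‖ψ e‖ ^ 2 = 1) :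
    ∑ o : Fin n → Label N with Achieves s T (List.ofFn o),
        prob N n (correctedProtocol s hs).basis ψ o = 1 - failureRate n s T := by
  calc
    _ = ∑ o : Fin n → Label N,
          if Achieves s T (List.ofFn o) then (1 / ((N : ℝ) ^ 2 - 1)) ^ n else 0 := by
      simp only [GateProtocol.prob_eq _ hψ, Finset.sum_filter]
    _ = 𝔼 o : Fin n → Label N, (1 - if Achieves s T (List.ofFn o) then (0 : ℝ) else 1) := by
      rw [Finset.expect_eq_sum_div_card, Finset.sum_div, Finset.card_univ, Fintype.card_fun,
        Fintype.card_fin, Nat.cast_pow, cast_card_label]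
      refine Finset.sum_congr rfl fun o _ => ?_
      split_ifs <;> simp
    _ = 1 - failureRate n s T := by
      rw [Finset.expect_sub_distrib, Fintype.expect_const, failureRate]

end Performs

section Torus

open BigOperators
open scoped Fin.CommRing

section DiagonalTorus

variable {n : Type*} [Fintype n] [DecidableEq n] (F : Matrix.unitaryGroup n ℂ)

/-- The maximal torus of the matrices that are diagonal in the orthonormal basis of the columns of
`F`, parametrized by the eigenvalues. -/
def torus : (n → ℂ) →ₐ[ℂ] Matrix n n ℂ :=
  (Unitary.conjStarAlgAut ℂ (Matrix n n ℂ) F).toAlgEquiv.toAlgHom.comp (Matrix.diagonalAlgHom ℂ)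

lemma torus_apply (d : n → ℂ) : torus F d = F * Matrix.diagonal d * (F : Matrix n n ℂ)ᴴ := rfl

lemma torus_conjTranspose (d : n → ℂ) : (torus F d)ᴴ = torus F (star d) := by
  simp [torus_apply, Matrix.diagonal_conjTranspose, mul_assoc]

lemma torus_mulVec_column (d : n → ℂ) (k : n) :
    torus F d *ᵥ (F *ᵥ Pi.single k 1) = d k • (F *ᵥ Pi.single k 1) := by
  have hF : (F : Matrix n n ℂ)ᴴ * F = 1 := Matrix.mem_unitaryGroup_iff'.1 F.2
  rw [torus_apply, Matrix.mulVec_mulVec, mul_assoc, hF, mul_one, ← Matrix.mulVec_mulVec,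
    Matrix.diagonal_mulVec_single, ← smul_eq_mul, Pi.single_smul, Matrix.mulVec_smul]

lemma complexReflection_column (k : n) (z : ℂ) :
    complexReflection (F *ᵥ Pi.single k 1) z = torus F (Pi.mulSingle k z) := by
  have hdiag : complexReflection (Pi.single k 1) z = Matrix.diagonal (Pi.mulSingle k z) := by
    ext i j
    rcases eq_or_ne i k with rfl | hik
    · rcases eq_or_ne i j with rfl | hij <;>
        simp_all [complexReflection, Matrix.vecMulVec_apply]
    · simp [complexReflection, Matrix.vecMulVec_apply, Matrix.diagonal_apply, Matrix.one_apply, hik]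
  rw [torus_apply, ← hdiag, unitary_mul_complexReflection_mul F.2]

lemma column_ne_zero (k : n) : (F : Matrix n n ℂ) *ᵥ Pi.single k 1 ≠ 0 := fun h => by
  have hone := dotProduct_mulVec_of_mem_unitaryGroup F.2 (Pi.single k 1) (Pi.single k 1)
  simp [h] at hone

/-- The gate that multiplies the column `k` of `F` by `z` and the column `l` by `z⁻¹`, where
`‖z‖ = 1`. -/
def twoPhase (z : ℂ) (k l : n) : Matrix n n ℂ :=
  torus F (Pi.mulSingle k z * Pi.mulSingle l (star z))

lemma twoPhase_self {z : ℂ} (hz : ‖z‖ = 1) (k : n) : twoPhase F z k k = 1 := by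
  rw [twoPhase, ← Pi.mulSingle_mul, mul_comm, star_mul_self_of_norm_eq_one hz, Pi.mulSingle_one,
    map_one]

lemma smul_prod_mulSingle_mul {z : ℂ} (hz : ‖z‖ = 1) (k : n) :
    z • ∏ l, (Pi.mulSingle k z * Pi.mulSingle l (star z)) =
      (Pi.mulSingle k (z ^ Fintype.card n) : n → ℂ) := by
  have hzz := star_mul_self_of_norm_eq_one hz
  rw [Finset.prod_mul_distrib, Finset.prod_const, Finset.card_univ,
    Finset.univ_prod_mulSingle fun _ : n => star z]
  ext j
  rw [Pi.smul_apply, Pi.mul_apply, Pi.pow_apply, smul_eq_mul]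
  rcases eq_or_ne j k with rfl | hjk
  · rw [Pi.mulSingle_eq_same, Pi.mulSingle_eq_same]
    linear_combination z ^ Fintype.card n * hzz
  · rw [Pi.mulSingle_eq_of_ne hjk, Pi.mulSingle_eq_of_ne hjk]
    linear_combination hzz

variable {F} in
lemma torus_mul_eq_mul_torus_comp {d : n → ℂ} (hd : Function.Injective d) {W : Matrix n n ℂ}
    {σ : n → n} (h : torus F d * W = W * torus F (d ∘ σ)) (e : n → ℂ) :
    torus F e * W = W * torus F (e ∘ σ) := by
  obtain ⟨M, rfl⟩ := (Unitary.conjStarAlgAut ℂ (Matrix n n ℂ) F).surjective W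
  have hentries : ∀ e e' : n → ℂ,
      torus F e * Unitary.conjStarAlgAut ℂ _ F M = Unitary.conjStarAlgAut ℂ _ F M * torus F e' ↔
        ∀ i j, e i * M i j = M i j * e' j := fun e e' => by
    change Unitary.conjStarAlgAut ℂ _ F (Matrix.diagonal e) * _ =
      _ * Unitary.conjStarAlgAut ℂ _ F (Matrix.diagonal e') ↔ _
    rw [← map_mul, ← map_mul, EmbeddingLike.apply_eq_iff_eq, ← Matrix.ext_iff]
    simp only [Matrix.diagonal_mul, Matrix.mul_diagonal]
  refine (hentries _ _).2 fun i j => ?_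
  rcases eq_or_ne (M i j) 0 with h0 | h0
  · rw [h0, mul_zero, zero_mul]
  · have hij := (hentries _ _).1 h i j
    rw [mul_comm, mul_right_inj' h0] at hij
    rw [Function.comp_apply, hd hij, mul_comm]

end DiagonalTorus

lemma expect_ite_zero_le {ι : Type*} [Fintype ι] [Nonempty ι] {p : ι → Prop} [DecidablePred p]
    {i₀ : ι} (hp : p i₀) {x : ℝ} (hx : 0 ≤ x) :
    𝔼 i, (if p i then 0 else x) ≤ (1 - 1 / Fintype.card ι) * x := by
  classical
  calc
    𝔼 i, (if p i then 0 else x) ≤ 𝔼 i, (x - if i = i₀ then x else 0) := by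
      refine Finset.expect_le_expect fun i _ => ?_
      split_ifs <;> simp_all
    _ = (1 - 1 / Fintype.card ι) * x := by
      rw [Finset.expect_sub_distrib, Fintype.expect_const, Finset.expect_eq_sum_div_card,
        Fintype.sum_ite_eq', Finset.card_univ]
      ring

section ShiftedTorus

variable {N : ℕ} [NeZero N] {a : Fin N × Fin N} {F : Matrix.unitaryGroup (Fin N) ℂ}

lemma torus_mul_hw (hF : hw N a = torus F (rootCharacter N)) (d : Fin N → ℂ) (p : Fin N × Fin N) :
    torus F d * hw N p = hw N p * torus F fun j => d (j + symplecticForm a p) := by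
  refine torus_mul_eq_mul_torus_comp rootCharacter_injective ?_ d
  have hshift : (rootCharacter N ∘ fun j => j + symplecticForm a p) =
      weylPhase a p • (rootCharacter N : Fin N → ℂ) := by
    ext j
    rw [Function.comp_apply, AddChar.map_add_eq_mul, mul_comm, Pi.smul_apply, smul_eq_mul,
      weylPhase]
  rw [hshift, map_smul, ← hF, mul_smul_comm, hw_mul_comm]

lemma inducedGate_torus (hF : hw N a = torus F (rootCharacter N)) (d : Fin N → ℂ) (α : Label N) :
    inducedGate N (torus F d) α =
      torus F ((fun j => star (d (j + symplecticForm a α.1))) * d) := by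
  rw [inducedGate, torus_conjTranspose, mul_assoc _ (torus F _), torus_mul_hw hF, ← mul_assoc,
    hw_conjTranspose_mul_self, one_mul, ← map_mul]
  rfl

lemma twoPhase_mul_conjTranspose_inducedGate (hF : hw N a = torus F (rootCharacter N))
    {z : ℂ} (hz : ‖z‖ = 1) (k l : Fin N) (α : Label N) :
    twoPhase F z k l * (inducedGate N (torus F (Pi.mulSingle k z)) α)ᴴ =
      twoPhase F z (k - symplecticForm a α.1) l := by
  rw [inducedGate_torus hF, torus_conjTranspose, twoPhase, twoPhase, ← map_mul]
  congr 1
  ext j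
  have hshift : (Pi.mulSingle k z : Fin N → ℂ) (j + symplecticForm a α.1) =
      (Pi.mulSingle (k - symplecticForm a α.1) z : Fin N → ℂ) j := by
    simp only [Pi.mulSingle_apply, eq_sub_iff_add_eq]
  have hunit : star ((Pi.mulSingle k z : Fin N → ℂ) j) * (Pi.mulSingle k z : Fin N → ℂ) j = 1 := by
    rcases eq_or_ne j k with rfl | hjk
    · rw [Pi.mulSingle_eq_same, star_mul_self_of_norm_eq_one hz]
    · rw [Pi.mulSingle_eq_of_ne hjk, star_one, one_mul]
  simp only [Pi.mul_apply, Pi.star_apply, star_mul', star_star, hshift]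
  linear_combination (Pi.mulSingle l (star z) : Fin N → ℂ) j *
    (Pi.mulSingle (k - symplecticForm a α.1) z : Fin N → ℂ) j * hunit

end ShiftedTorus

section Walk

variable {N : ℕ} [N.AtLeastTwo] {a : Fin N × Fin N} {F : Matrix.unitaryGroup (Fin N) ℂ}
  {z : ℂ}

lemma isElementaryGate_torus_mulSingle (ha : IsAxis a)
    (hF : hw N a = torus F (rootCharacter N)) (hz : ‖z‖ = 1) (k : Fin N) :
    IsElementaryGate N (torus F (Pi.mulSingle k z)) :=
  isElementaryGate_iff.2 ⟨a, ha, F *ᵥ Pi.single k 1, rootCharacter N k, z, column_ne_zero F k, hz,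
    by rw [hF, torus_mulVec_column], (complexReflection_column F k z).symm⟩

-- Measuring the gate of the column `k` moves the phase `z` that is still to be performed to the
-- column `k - symplecticForm a α`, which is `l` for at least one of the outcomes `α`.
lemma performs_twoPhase (ha : IsAxis a) (hF : hw N a = torus F (rootCharacter N)) (hz : ‖z‖ = 1)
    (n : ℕ) (k l : Fin N) :
    Performs n (twoPhase F z k l) ((1 - 1 / Fintype.card (Label N) : ℝ) ^ n) := by
  have hrate : (0 : ℝ) ≤ 1 - 1 / Fintype.card (Label N) :=
    sub_nonneg.2 (div_le_one_of_le₀ (Nat.one_le_cast.2 Fintype.card_pos) (Nat.cast_nonneg _))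
  induction n generalizing k with
  | zero => exact .giveUp (pow_zero _).ge
  | succ n ih =>
    have hdone : ∀ {q : ℝ} {n : ℕ}, 0 ≤ q → Performs n (twoPhase F z l l) q := fun hq => by
      rw [twoPhase_self F hz, ← one_smul ℂ (1 : Matrix (Fin N) (Fin N) ℂ)]
      exact .done one_ne_zero hq
    rcases eq_or_ne k l with rfl | hkl
    · exact hdone (pow_nonneg hrate _)
    · obtain ⟨α₀, hα₀⟩ := ha.exists_symplecticForm_eq (sub_ne_zero.2 hkl)
      refine .measure (isElementaryGate_torus_mulSingle ha hF hz k)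
        (fun α => if k - symplecticForm a α.1 = l then 0 else
          (1 - 1 / Fintype.card (Label N) : ℝ) ^ n) (fun α => ?_) ?_
      · rw [twoPhase_mul_conjTranspose_inducedGate hF hz]
        split_ifs with hαl
        · rw [hαl]
          exact hdone le_rfl
        · exact ih _
      · rw [pow_succ']
        exact expect_ite_zero_le (i₀ := α₀) (by rw [hα₀, sub_sub_cancel]) (pow_nonneg hrate _)

lemma twoPhase_mem_performable (ha : IsAxis a) (hF : hw N a = torus F (rootCharacter N))
    (hz : ‖z‖ = 1) (k l : Fin N) : twoPhase F z k l ∈ performable N := fun ε hε => by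
  have hlt : (1 - 1 / Fintype.card (Label N) : ℝ) < 1 :=
    sub_lt_self _ (one_div_pos.2 (Nat.cast_pos.2 Fintype.card_pos))
  obtain ⟨n, hn⟩ := exists_pow_lt_of_lt_one hε hlt
  exact ⟨n, (performs_twoPhase ha hF hz n k l).mono le_rfl hn.le⟩

lemma reflects_column (ha : IsAxis a) (hF : hw N a = torus F (rootCharacter N)) (k : Fin N) :
    Reflects (performable N) (F *ᵥ Pi.single k 1) := fun w hw => by
  obtain ⟨z, rfl⟩ := IsAlgClosed.exists_pow_nat_eq w (NeZero.pos N)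
  have hz : ‖z‖ = 1 := by
    rwa [norm_pow, pow_eq_one_iff_of_nonneg (norm_nonneg _) (NeZero.ne N)] at hw
  have hprod := smul_prod_mulSingle_mul hz k
  rw [Fintype.card_fin] at hprod
  rw [complexReflection_column, ← hprod, map_smul]
  refine smul_mem_performable ?_ (norm_ne_zero_iff.1 (hz ▸ one_ne_zero))
  exact Submonoid.prod_mem ((performable N).comap (torus F)) fun l _ =>
    twoPhase_mem_performable ha hF hz k l

end Walk

section Frames

variable (N : ℕ)

lemma hw_eq_torus_one [NeZero N] : hw N (0, 1) = torus 1 (rootCharacter N) := by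
  ext a b
  rcases eq_or_ne a b with rfl | hab
  · simp [torus_apply, hw_apply]
  · simp [torus_apply, hw_apply, hab, hab.symm]

/-- The discrete Fourier transform, which diagonalizes the shift. -/
def fourier [NeZero N] : Matrix.unitaryGroup (Fin N) ℂ :=
  ⟨(1 / Real.sqrt N : ℂ) • Matrix.of fun a k => rootCharacter N (a * k), by
    have hsqrt : (Real.sqrt N : ℂ) * Real.sqrt N = N := by
      exact_mod_cast Real.mul_self_sqrt (Nat.cast_nonneg N)
    have hN : (N : ℂ) ≠ 0 := NeZero.ne _
    rw [Matrix.mem_unitaryGroup_iff']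
    ext j k
    have hsum : ∑ a, star (rootCharacter N (a * j)) * rootCharacter N (a * k) =
        if j = k then (N : ℂ) else 0 := by
      simp only [star_rootCharacter, ← AddChar.map_add_eq_mul, neg_add_eq_sub, ← mul_sub]
      rw [AddChar.sum_mulShift _ rootCharacter_isPrimitive]
      simp [sub_eq_zero, eq_comm]
    have hscalar : star (1 / Real.sqrt N : ℂ) * (1 / Real.sqrt N) = 1 / N := by
      rw [Complex.star_def, map_div₀, map_one, Complex.conj_ofReal, div_mul_div_comm, hsqrt,
        one_mul]
    rw [star_smul, smul_mul_smul_comm, hscalar, Matrix.smul_apply, Matrix.mul_apply]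
    simp only [Matrix.star_apply, Matrix.of_apply, hsum, Matrix.one_apply]
    rw [smul_ite, smul_zero, smul_eq_mul, one_div_mul_cancel hN]⟩

lemma hw_eq_torus_fourier [NeZero N] : hw N (1, 0) = torus (fourier N) (rootCharacter N) := by
  have hF : (fourier N : Matrix (Fin N) (Fin N) ℂ) * (fourier N : Matrix (Fin N) (Fin N) ℂ)ᴴ = 1 :=
    Matrix.mem_unitaryGroup_iff.1 (fourier N).2
  have hcomm : hw N (1, 0) * (fourier N : Matrix (Fin N) (Fin N) ℂ) =
      fourier N * Matrix.diagonal (rootCharacter N) := by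
    ext a k
    rw [Matrix.mul_diagonal]
    change (hw N (1, 0) *ᵥ fun i => (fourier N : Matrix (Fin N) (Fin N) ℂ) i k) a = _
    rw [hw_mulVec_apply]
    simp [fourier, add_mul, AddChar.map_add_eq_mul, mul_assoc]
  rw [torus_apply, ← hcomm, mul_assoc, hF, mul_one]

variable {N} [N.AtLeastTwo] {T : Matrix (Fin N) (Fin N) ℂ}

lemma unitary_mem_performable (hT : T ∈ Matrix.unitaryGroup (Fin N) ℂ) : T ∈ performable N := by
  refine unitary_mem_of_reflects (Reflects.of_single_of_one (fun i => ?_) ?_) hT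
  · have hcol := reflects_column (Or.inr rfl) (hw_eq_torus_one N) i
    rwa [OneMemClass.coe_one, Matrix.one_mulVec] at hcol
  · have hcol : (fourier N : Matrix (Fin N) (Fin N) ℂ) *ᵥ Pi.single 0 1 =
        (1 / Real.sqrt N : ℂ) • 1 := by
      ext a
      simp [fourier]
    have h0 : (1 / Real.sqrt N : ℂ) ≠ 0 :=
      one_div_ne_zero <| Complex.ofReal_ne_zero.2 <| Real.sqrt_ne_zero'.2 <|
        Nat.cast_pos.2 (NeZero.pos N)
    exact Reflects.of_smul h0 (hcol ▸ reflects_column (Or.inl rfl) (hw_eq_torus_fourier N) 0)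

open Classical in
lemma exists_protocol (hT : T ∈ Matrix.unitaryGroup (Fin N) ℂ) {ε : ℝ} (hε : 0 < ε) :
    ∃ (P : GateProtocol N) (n : ℕ) (S : Finset (Fin n → Label N))
      (b : (Fin n → Label N) → Fin N × Fin N),
      (∀ o ∈ S, ∃ c : ℂ, c ≠ 0 ∧
        ∀ ψ, postState N n P.basis ψ o = c • ((hw N (b o) * T) *ᵥ ψ)) ∧
      ∀ ψ : Fin N → ℂ, ∑ e, ‖ψ e‖ ^ 2 = 1 → 1 - ε ≤ ∑ o ∈ S, prob N n P.basis ψ o := by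
  obtain ⟨n, hn⟩ := unitary_mem_performable hT ε hε
  obtain ⟨s, hs, hrate⟩ := hn.exists_failureRate_le
  refine ⟨correctedProtocol s hs, n, Finset.univ.filter fun o => Achieves s T (List.ofFn o),
    fun o => byproduct (List.ofFn o), fun o ho => ?_, fun ψ hψ => ?_⟩
  · obtain ⟨c, hc, hachieves⟩ := (Finset.mem_filter.1 ho).2
    obtain ⟨c', hc', hvirtual⟩ := (correctedProtocol s hs).exists_virtualOp_eq o
    refine ⟨c' * c, mul_ne_zero hc' hc, fun ψ => ?_⟩
    rw [postState_eq_virtualOp_mulVec, hvirtual, correctedGate_correctedProtocol, hachieves,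
      mul_smul_comm, smul_smul, Matrix.smul_mulVec]
  · rw [sum_prob_correctedProtocol hs n T hψ]
    exact sub_le_sub_left hrate 1

end Frames

end Torus

end AKLT

end

open Classical in
theorem proposition3 (N : ℕ) (hN : 2 ≤ N) :
    -- the AKLT state is normalized
    (∀ (n : ℕ) (ψ : Fin N → ℂ), ∑ e, ‖ψ e‖ ^ 2 = 1 →
      ∑ s, ∑ e, ‖AKLT.akltState N n ψ s e‖ ^ 2 = 1) ∧
    -- adaptive on-site measurements act on the virtual space by products of Kraus operators
    (∀ (n : ℕ) (B : List (AKLT.Label N) → AKLT.SiteBasis N) (ψ : Fin N → ℂ)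
      (o : Fin n → AKLT.Label N),
      AKLT.postState N n B ψ o = AKLT.virtualOp N n B o *ᵥ ψ) ∧
    -- in a suitable on-site basis the Kraus operators are the Gell-Mann matrices, and a unitary
    -- rotation turns them into the Heisenberg–Weyl operators
    (∃ M : AKLT.SiteBasis N,
      (∀ β, (M β : AKLT.PairSpace N) = AKLT.toPair N ((Real.sqrt 2 : ℂ) • AKLT.gellMann N β)) ∧
      (∀ β, AKLT.kraus N (M β) =
        ((Real.sqrt (2 * N / ((N : ℝ) ^ 2 - 1)) : ℝ) : ℂ) • AKLT.gellMann N β) ∧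
      ∃ U ∈ Matrix.unitaryGroup (AKLT.Label N) ℂ, ∀ α,
        ∑ β, U α β • AKLT.kraus N (M β) =
          ((1 / Real.sqrt ((N : ℝ) ^ 2 - 1) : ℝ) : ℂ) • AKLT.hw N α.1) ∧
    -- the Heisenberg–Weyl operators are unitary, and the basis rotated by `V` exists and induces
    -- the operators `V† W V`
    (∀ p, AKLT.hw N p ∈ Matrix.unitaryGroup (Fin N) ℂ) ∧
    (∀ V ∈ Matrix.unitaryGroup (Fin N) ℂ,
      (∃ B : AKLT.SiteBasis N, AKLT.IsRotatedBy N V B) ∧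
      ∀ B : AKLT.SiteBasis N, AKLT.IsRotatedBy N V B → ∀ α,
        AKLT.kraus N (B α) =
          ((1 / Real.sqrt ((N : ℝ) ^ 2 - 1) : ℝ) : ℂ) • (Vᴴ * AKLT.hw N α.1 * V) ∧
        AKLT.kraus N (B α) =
          ((1 / Real.sqrt ((N : ℝ) ^ 2 - 1) : ℝ) : ℂ) •
            (AKLT.hw N α.1 * AKLT.inducedGate N V α)) ∧
    -- the outcomes are uniformly distributed, and every sequence of outcomes performs some gate of
    -- `SU(N)`, up to a Heisenberg–Weyl byproduct
    (∀ (P : AKLT.GateProtocol N) (n : ℕ) (o : Fin n → AKLT.Label N),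
      (∀ ψ : Fin N → ℂ, ∑ e, ‖ψ e‖ ^ 2 = 1 →
        AKLT.prob N n P.basis ψ o = (1 / ((N : ℝ) ^ 2 - 1)) ^ n) ∧
      ∃ G ∈ Matrix.specialUnitaryGroup (Fin N) ℂ, ∃ (b : Fin N × Fin N) (c : ℂ), c ≠ 0 ∧
        ∀ ψ, AKLT.postState N n P.basis ψ o = c • ((AKLT.hw N b * G) *ᵥ ψ)) ∧
    -- a single measurement induces a gate of `SU(N)`; the gate is the identity (failure) or
    -- nontrivial (success), the latter with conditional probability `N / (N + 1)`
    (∀ V, AKLT.IsElementaryGate N V → ∀ α : AKLT.Label N,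
      AKLT.inducedGate N V α ∈ Matrix.specialUnitaryGroup (Fin N) ℂ ∧
      (AKLT.inducedGate N V α = 1 ↔ Commute V (AKLT.hw N α.1)) ∧
      ((2 < N ∨ V * V ≠ 1) → AKLT.inducedGate N V α ≠ 1 →
        ∀ z : ℂ, AKLT.inducedGate N V α ≠ z • 1)) ∧
    (∀ (P : AKLT.GateProtocol N) (n : ℕ) (o : Fin n → AKLT.Label N) (ψ : Fin N → ℂ),
      ∑ e, ‖ψ e‖ ^ 2 = 1 → P.gate (List.ofFn o) ≠ 1 →
      ∑ α with AKLT.inducedGate N (P.gate (List.ofFn o)) α ≠ 1,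
          AKLT.prob N (n + 1) P.basis ψ (Fin.snoc o α) =
        (N / (N + 1) : ℝ) * AKLT.prob N n P.basis ψ o) ∧
    -- every gate of `SU(N)` is performed, up to a known Heisenberg–Weyl byproduct, with probability
    -- arbitrarily close to `1` on a long enough chain
    (∀ T ∈ Matrix.specialUnitaryGroup (Fin N) ℂ, ∀ ε : ℝ, 0 < ε →
      ∃ (P : AKLT.GateProtocol N) (n : ℕ) (S : Finset (Fin n → AKLT.Label N))
        (b : (Fin n → AKLT.Label N) → Fin N × Fin N),
        (∀ o ∈ S, ∃ c : ℂ, c ≠ 0 ∧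
          ∀ ψ, AKLT.postState N n P.basis ψ o = c • ((AKLT.hw N (b o) * T) *ᵥ ψ)) ∧
        ∀ ψ : Fin N → ℂ, ∑ e, ‖ψ e‖ ^ 2 = 1 →
          1 - ε ≤ ∑ o ∈ S, AKLT.prob N n P.basis ψ o) := by
  have : N.AtLeastTwo := ⟨hN⟩
  refine ⟨fun n ψ hψ => (AKLT.sum_norm_akltState n ψ).trans hψ,
    fun n B ψ o => AKLT.postState_eq_virtualOp_mulVec B ψ o, ?gellMann,
    AKLT.hw_mem_unitaryGroup, fun V hV => ⟨AKLT.exists_isRotatedBy hV, fun B hB α => ?_⟩,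
    fun P n o => ⟨fun ψ hψ => P.prob_eq hψ o, P.exists_postState_eq o⟩,
    fun V hV α => ⟨AKLT.inducedGate_mem_specialUnitaryGroup hV.mem_unitaryGroup α,
      AKLT.inducedGate_eq_one_iff_commute hV.mem_unitaryGroup α,
      fun h => hV.inducedGate_ne_smul_one h⟩,
    fun P n o ψ _ hgate => P.sum_prob_inducedGate_ne_one ψ hgate,
    fun T hT ε hε => AKLT.exists_protocol (Matrix.specialUnitaryGroup_le_unitaryGroup hT) hε⟩
  case gellMann =>
    obtain ⟨M, hM⟩ := AKLT.exists_gellMann_basis (N := N)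
    obtain ⟨B, hB⟩ := AKLT.exists_isRotatedBy (one_mem (Matrix.unitaryGroup (Fin N) ℂ))
    obtain ⟨U, hU, hkraus⟩ := AKLT.exists_unitary_kraus B M
    refine ⟨M, hM, fun β => by rw [hM, AKLT.kraus_gellMann], U, hU, fun α => ?_⟩
    rw [hkraus, hB.kraus, Matrix.conjTranspose_one, one_mul, mul_one]
  · rw [AKLT.hw_mul_inducedGate]
    exact ⟨hB.kraus α, hB.kraus α⟩
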